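/- All manifolds are smooth, finite-dimensional, Hausdorff and $\sigma$-compact. A Courant algebroid on $M$ is a vector bundle $F\to M$ with an $\mathbb R$-bilinear (Dorfman) bracket on $\Gamma(F)$, a nondegenerate symmetric pairing $\langle\ ,\ \rangle$ and an anchor $\rho:F\to TM$ such that $[a,[b,c]]=[[a,b],c]+[b,[a,c]]$, $\rho[a,b]=[\rho(a),\rho(b)]$, $[a,fb]=\rho(a)(f)b+f[a,b]$, $[a,b]+[b,a]=2\,d\langle a,b\rangle$ (where $\langle df,c\rangle=\tfrac12\rho(c)(f)$), and $\rho(a)\langle b,c\rangle=\langle[a,b],c\rangle+\langle b,[a,c]\rangle$. It is exact if $0\to T^*M\xrightarrow{\frac12\rho^*}F\xrightarrow{\rho}TM\to0$ is exact. A generalized complex structure on $F$ is a bundle endomorphism $J$ with $J^2=-1$, $\langle Ja,Jb\rangle=\langle a,b\rangle$, and sections of its $+i$-eigenbundle in $F\otimes\mathbb C$ closed under the bracket. A holomorphic family of generalized complex structures consists of a smooth locally trivial fibre bundle $\pi:M\to B$, an exact Courant algebroid $F\to M$, a generalized complex structure $J$ on $F$ and a complex structure $I$ on $B$ such that $A=\ker(\pi_*\circ\rho)\subseteq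 F$ is $J$-invariant and the complex structure induced by $J$ on $F/A\cong\pi^*TB$ is $-\pi^*I$. Then the bracket, pairing, anchor and $J$ of $F$ descend to $E=A/A^\perp$; let $L\subset E\otimes\mathbb C$ be the $+i$-eigenbundle of the induced structure. It is a complex Lie algebroid over $M$; let $H^2(L)$ be the second cohomology of its complex $(\Gamma(\wedge^\bullet L^*),d_L)$. For a vector field $X$ on $B$, call $\tilde X\in\Gamma(F)$ a lift of $X$ if $\pi_*\rho(\tilde X)=X\circ\pi$; then $[\tilde X,\cdot]$ induces a derivation $D$ of $E$. The generalized Kodaira–Spencer class $\kappa(X)\in H^2(L)$ is the class of $(a,b)\mapsto\langle Da,b\rangle$, $a,b\in\Gamma(L)$. **Proposition.** For every holomorphic family of generalized complex structures, every vector field $X$ on $B$ has a lift, the element $(a,b)\mapsto\langle Da,b\rangle$ of $\Gamma(\wedge^2L^*)$ is $d_L$-closed and its class $\kappa(X)\in H^2(L)$ does not depend on the lift; the map $\kappa:\Gamma(TB)\to H^2(L)$ is real linear, and it is complex linear in the sense that $$\kappa(IX)=i\,\kappa(X)$$ for every vector field $X$ on $B$. -/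

import Mathlib

open scoped Manifold ContDiff TensorProduct Bundle

noncomputable section

namespace GenCx

/-! ### Linear algebra

`ℂ ⊗[ℝ] N` is the complexification of `N`; linear and bilinear maps are extended
complex (bi)linearly. -/

section Complexification

variable {N P Q : Type*} [AddCommGroup N] [Module ℝ N] [AddCommGroup P] [Module ℝ P]
  [AddCommGroup Q] [Module ℝ Q]

/-- The complex bilinear extension of a real bilinear map:
`(z ⊗ n, w ⊗ p) ↦ zw ⊗ f n p`. -/
def complexify₂ (f : N →ₗ[ℝ] P →ₗ[ℝ] Q) : ℂ ⊗[ℝ] N →ₗ[ℂ] ℂ ⊗[ℝ] P →ₗ[ℂ] ℂ ⊗[ℝ] Q :=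
  ((LinearMap.baseChangeHom ℝ ℂ P Q) ∘ₗ f).liftBaseChange ℂ

@[simp] lemma complexify₂_tmul (f : N →ₗ[ℝ] P →ₗ[ℝ] Q) (z w : ℂ) (n : N) (p : P) :
    complexify₂ f (z ⊗ₜ n) (w ⊗ₜ p) = (z * w) ⊗ₜ f n p := by
  simp [complexify₂, LinearMap.baseChangeHom, TensorProduct.smul_tmul']

/-- A bilinear map that vanishes on given subspaces descends to the quotients. -/
def liftQ₂ (S : Submodule ℝ N) (T : Submodule ℝ P)
    (f : N →ₗ[ℝ] P →ₗ[ℝ] Q) (h : ∀ a ∈ S, ∀ b, f a b = 0) (h' : ∀ a, ∀ b ∈ T, f a b = 0) :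
    N ⧸ S →ₗ[ℝ] P ⧸ T →ₗ[ℝ] Q :=
  S.liftQ
    { toFun a := T.liftQ (f a) (h' a)
      map_add' a b := Submodule.linearMap_qext _ (LinearMap.ext fun c => LinearMap.map_add₂ f a b c)
      map_smul' r a :=
        Submodule.linearMap_qext _ (LinearMap.ext fun c => LinearMap.map_smul₂ f r a c) }
    (fun a ha => Submodule.linearMap_qext _ (LinearMap.ext fun c => h a ha c))

@[simp] lemma liftQ₂_mk (S : Submodule ℝ N) (T : Submodule ℝ P)
    (f : N →ₗ[ℝ] P →ₗ[ℝ] Q) (h : ∀ a ∈ S, ∀ b, f a b = 0) (h' : ∀ a, ∀ b ∈ T, f a b = 0)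
    (a : N) (b : P) :
    liftQ₂ S T f h h' (Submodule.Quotient.mk a) (Submodule.Quotient.mk b) = f a b := rfl

end Complexification

/-! ### Lie algebroid cohomology in degree two -/

/-- The quotient `Z / (Z ∩ B)` of subspaces of a complex vector space. -/
def Subquotient {C : Type*} [AddCommGroup C] [Module ℂ C] (Z B : Submodule ℂ C) : Type _ :=
  Z ⧸ B.submoduleOf Z

section Subquotient

variable {C : Type*} [AddCommGroup C] [Module ℂ C] (Z B : Submodule ℂ C)

instance : AddCommGroup (Subquotient Z B) := inferInstanceAs (AddCommGroup (Z ⧸ B.submoduleOf Z))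

instance : Module ℂ (Subquotient Z B) := inferInstanceAs (Module ℂ (Z ⧸ B.submoduleOf Z))

/-- The class of an element of `Z`. -/
def Subquotient.mk : Z →ₗ[ℂ] Subquotient Z B := (B.submoduleOf Z).mkQ

lemma Subquotient.mk_eq_zero_iff (z : Z) : Subquotient.mk Z B z = 0 ↔ z.1 ∈ B :=
  Submodule.Quotient.mk_eq_zero _

end Subquotient

/-- The operations on the sections `L` of a complex Lie algebroid over a manifold with complex
function algebra `F`: multiplication by functions, anchor (acting on functions) and bracket. -/
structure LieAlgebroidOps (F L : Type*) [CommRing F] [Algebra ℂ F] [AddCommGroup L]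
    [Module ℂ L] where
  smul : F → L → L
  act : L → F →ₗ[ℂ] F
  bracket : L → L → L

namespace LieAlgebroidOps

variable {F L : Type*} [CommRing F] [Algebra ℂ F] [AddCommGroup L] [Module ℂ L]
  (O : LieAlgebroidOps F L)

/-- `Γ(∧^k L^*)`: alternating maps `Γ(L)^k → C^∞(M, ℂ)` that are linear over `C^∞(M, ℂ)`. -/
def Cochain (k : ℕ) : Submodule ℂ (L [⋀^Fin k]→ₗ[ℂ] F) where
  carrier := {θ | ∀ (f : F) (v : Fin k → L) (i : Fin k),
    θ (Function.update v i (O.smul f (v i))) = f * θ v}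
  add_mem' hθ hη f v i := by
    simp only [AlternatingMap.add_apply, hθ f v i, hη f v i, mul_add]
  zero_mem' f v i := by simp
  smul_mem' c θ hθ f v i := by
    simp only [AlternatingMap.smul_apply, hθ f v i, mul_smul_comm]

/-- The Lie algebroid differential in degree one:
`(d η)(a,b) = ρ(a)η(b) - ρ(b)η(a) - η([a,b])`. -/
def d₁ (η : L [⋀^Fin 1]→ₗ[ℂ] F) (a b : L) : F :=
  O.act a (η ![b]) - O.act b (η ![a]) - η ![O.bracket a b]

/-- The Lie algebroid differential in degree two:
`(d θ)(a,b,c) = ρ(a)θ(b,c) - ρ(b)θ(a,c) + ρ(c)θ(a,b) - θ([a,b],c) + θ([a,c],b) - θ([b,c],a)`. -/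
def d₂ (θ : L [⋀^Fin 2]→ₗ[ℂ] F) (a b c : L) : F :=
  O.act a (θ ![b, c]) - O.act b (θ ![a, c]) + O.act c (θ ![a, b])
    - θ ![O.bracket a b, c] + θ ![O.bracket a c, b] - θ ![O.bracket b c, a]

/-- Closed elements of `Γ(∧² L^*)`. -/
def Z2 : Submodule ℂ (L [⋀^Fin 2]→ₗ[ℂ] F) where
  carrier := {θ | θ ∈ O.Cochain 2 ∧ ∀ a b c, O.d₂ θ a b c = 0}
  add_mem' {θ η} hθ hη := by
    refine ⟨(O.Cochain 2).add_mem hθ.1 hη.1, fun a b c => ?_⟩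
    refine Eq.trans ?_ ((congrArg₂ (· + ·) (hθ.2 a b c) (hη.2 a b c)).trans (add_zero 0))
    simp only [d₂, AlternatingMap.add_apply, map_add]
    abel
  zero_mem' := ⟨(O.Cochain 2).zero_mem, fun a b c => by simp [d₂]⟩
  smul_mem' z θ hθ := by
    refine ⟨(O.Cochain 2).smul_mem z hθ.1, fun a b c => ?_⟩
    refine Eq.trans ?_ ((congrArg (z • ·) (hθ.2 a b c)).trans (smul_zero z))
    simp only [d₂, AlternatingMap.smul_apply, map_smul, smul_add, smul_sub]

/-- Exact elements of `Γ(∧² L^*)`. -/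
def B2 : Submodule ℂ (L [⋀^Fin 2]→ₗ[ℂ] F) where
  carrier := {θ | θ ∈ O.Cochain 2 ∧ ∃ η ∈ O.Cochain 1, ∀ a b, θ ![a, b] = O.d₁ η a b}
  add_mem' := by
    rintro θ θ' ⟨hθ, η, hη, h⟩ ⟨hθ', η', hη', h'⟩
    refine ⟨(O.Cochain 2).add_mem hθ hθ', η + η', (O.Cochain 1).add_mem hη hη', fun a b => ?_⟩
    simp only [AlternatingMap.add_apply, h, h', d₁, map_add]
    abel
  zero_mem' := ⟨(O.Cochain 2).zero_mem, 0, (O.Cochain 1).zero_mem,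
    fun a b => by simp [d₁]⟩
  smul_mem' := by
    rintro z θ ⟨hθ, η, hη, h⟩
    refine ⟨(O.Cochain 2).smul_mem z hθ, z • η, (O.Cochain 1).smul_mem z hη, fun a b => ?_⟩
    simp only [AlternatingMap.smul_apply, h, d₁, map_smul, smul_sub]

/-- The Lie algebroid cohomology `H²(L)`: closed modulo exact. -/
abbrev H2 : Type _ := Subquotient O.Z2 O.B2

/-- The cohomology class of a closed element. -/
def toH2 : O.Z2 →ₗ[ℂ] O.H2 := Subquotient.mk O.Z2 O.B2

lemma toH2_surjective : Function.Surjective O.toH2 := Submodule.mkQ_surjective _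

lemma toH2_eq_zero_iff (θ : O.Z2) : O.toH2 θ = 0 ↔ θ.1 ∈ O.B2 :=
  Subquotient.mk_eq_zero_iff O.Z2 O.B2 θ

end LieAlgebroidOps

/-! ### Smooth functions, vector fields, sections -/

section Manifold

variable (EM : Type*) [NormedAddCommGroup EM] [NormedSpace ℝ EM]
  (M : Type*) [TopologicalSpace M] [ChartedSpace EM M]

/-- Smooth real functions `C^∞(M)`. -/
abbrev SmoothFun := C^∞⟮𝓘(ℝ, EM), M; ℝ⟯

/-- Smooth vector fields `Γ(TM)`. -/
abbrev VectorFields [IsManifold 𝓘(ℝ, EM) ∞ M] :=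
  Cₛ^∞⟮𝓘(ℝ, EM); EM, (TangentSpace 𝓘(ℝ, EM) : M → Type _)⟯

variable {EM M}

/-- The derivative `v(f)` of a function `f` along a tangent vector `v`. -/
def dirDeriv (f : M → ℝ) (x : M) (v : TangentSpace 𝓘(ℝ, EM) x) : ℝ :=
  mfderiv 𝓘(ℝ, EM) 𝓘(ℝ, ℝ) f x v

lemma contMDiff_dirDeriv [IsManifold 𝓘(ℝ, EM) ∞ M] (X : VectorFields EM M) (f : SmoothFun EM M) :
    ContMDiff 𝓘(ℝ, EM) 𝓘(ℝ, ℝ) ∞ (fun x => dirDeriv f x (X x)) := by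
  have h1 := (f.contMDiff.contMDiff_tangentMap (m := ∞) le_rfl).comp X.contMDiff
  exact (contMDiff_snd_tangentBundle_modelSpace ℝ 𝓘(ℝ, ℝ)).comp h1

/-- The action `X, f ↦ X(f)` of vector fields on functions. -/
def fieldDeriv [IsManifold 𝓘(ℝ, EM) ∞ M] :
    VectorFields EM M →ₗ[ℝ] SmoothFun EM M →ₗ[ℝ] SmoothFun EM M :=
  LinearMap.mk₂ ℝ (fun X f => ⟨fun x => dirDeriv f x (X x), contMDiff_dirDeriv X f⟩)
    (fun X Y f => by ext x; exact map_add (mfderiv 𝓘(ℝ, EM) 𝓘(ℝ, ℝ) f x) (X x) (Y x))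
    (fun c X f => by ext x; exact map_smul (mfderiv 𝓘(ℝ, EM) 𝓘(ℝ, ℝ) f x) c (X x))
    (fun X f g => by
      ext x
      have hf : MDifferentiableAt 𝓘(ℝ, EM) 𝓘(ℝ, ℝ) f x :=
        f.contMDiff.mdifferentiable (by simp) x
      have hg : MDifferentiableAt 𝓘(ℝ, EM) 𝓘(ℝ, ℝ) g x :=
        g.contMDiff.mdifferentiable (by simp) x
      exact congrArg (fun T => T (X x)) (mfderiv_add hf hg))
    (fun c X f => by
      ext x
      have hf : MDifferentiableAt 𝓘(ℝ, EM) 𝓘(ℝ, ℝ) f x :=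
        f.contMDiff.mdifferentiable (by simp) x
      exact congrArg (fun T => T (X x)) (const_smul_mfderiv hf c))

lemma fieldDeriv_apply [IsManifold 𝓘(ℝ, EM) ∞ M] (X : VectorFields EM M) (f : SmoothFun EM M)
    (x : M) : fieldDeriv X f x = dirDeriv f x (X x) := rfl

end Manifold

/-! ### Courant algebroids and generalized complex structures -/

section Courant

variable (EM : Type*) [NormedAddCommGroup EM] [NormedSpace ℝ EM]
  {M : Type*} [TopologicalSpace M] [ChartedSpace EM M] [IsManifold 𝓘(ℝ, EM) ∞ M]
  (FF : Type*) [NormedAddCommGroup FF] [NormedSpace ℝ FF]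
  (V : M → Type*) [TopologicalSpace (Bundle.TotalSpace FF V)]
  [∀ x, AddCommGroup (V x)] [∀ x, Module ℝ (V x)] [∀ x, TopologicalSpace (V x)]
  [FiberBundle FF V] [VectorBundle ℝ FF V]

/-- Smooth sections `Γ(V)` of a smooth real vector bundle `V → M`. -/
abbrev Sections := Cₛ^∞⟮𝓘(ℝ, EM); FF, V⟯

/-- The multiplication `f, s ↦ f s` of sections by smooth functions. -/
def funSmul : SmoothFun EM M →ₗ[ℝ] Sections EM FF V →ₗ[ℝ] Sections EM FF V :=
  LinearMap.mk₂ ℝ (fun f s => ⟨(f : M → ℝ) • (s : ∀ x, V x), f.contMDiff.smul_section s.contMDiff⟩)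
    (fun f g s => by ext x; exact add_smul (f x) (g x) (s x))
    (fun c f s => by ext x; exact mul_smul c (f x) (s x))
    (fun f s t => by ext x; exact smul_add (f x) (s x) (t x))
    (fun c f s => by ext x; exact smul_comm (f x) c (s x))

variable {EM FF V} in
set_option linter.unusedSectionVars false in
@[simp] lemma funSmul_apply (f : SmoothFun EM M) (s : Sections EM FF V) (x : M) :
    funSmul EM FF V f s x = f x • s x := rfl

/-- A Courant algebroid with underlying smooth vector bundle `V → M`: a Dorfman bracket on
sections, a smooth nondegenerate symmetric pairing and a smooth anchor `V → TM`, such that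
* `[a,[b,c]] = [[a,b],c] + [b,[a,c]]`,
* `ρ[a,b] = [ρ(a),ρ(b)]`,
* `[a,fb] = ρ(a)(f) b + f[a,b]`,
* `[a,b] + [b,a] = 2 d⟨a,b⟩`, where `⟨df,c⟩ = ½ ρ(c)(f)`,
* `ρ(a)⟨b,c⟩ = ⟨[a,b],c⟩ + ⟨b,[a,c]⟩`. -/
structure CourantAlgebroid where
  bracket : Sections EM FF V →ₗ[ℝ] Sections EM FF V →ₗ[ℝ] Sections EM FF V
  pairing : ∀ x, LinearMap.BilinForm ℝ (V x)
  anchor : ∀ x, V x →ₗ[ℝ] TangentSpace 𝓘(ℝ, EM) x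
  pairing_smooth : ∀ a b : Sections EM FF V,
    ContMDiff 𝓘(ℝ, EM) 𝓘(ℝ, ℝ) ∞ (fun x => pairing x (a x) (b x))
  pairing_symm : ∀ x, (pairing x).IsSymm
  pairing_nondegenerate : ∀ x, (pairing x).Nondegenerate
  anchor_smooth : ∀ a : Sections EM FF V,
    ContMDiff 𝓘(ℝ, EM) 𝓘(ℝ, EM).tangent ∞
      (fun x => (⟨x, anchor x (a x)⟩ : TangentBundle 𝓘(ℝ, EM) M))
  bracket_jacobi : ∀ a b c,
    bracket a (bracket b c) = bracket (bracket a b) c + bracket b (bracket a c)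
  anchor_bracket : ∀ (a b : Sections EM FF V) (x : M),
    anchor x (bracket a b x) = VectorField.mlieBracket 𝓘(ℝ, EM)
      (fun y => anchor y (a y)) (fun y => anchor y (b y)) x
  bracket_smul : ∀ (a b : Sections EM FF V) (f : SmoothFun EM M) (x : M),
    bracket a (funSmul EM FF V f b) x = dirDeriv f x (anchor x (a x)) • b x + f x • bracket a b x
  bracket_add_swap : ∀ (a b : Sections EM FF V) (x : M) (c : V x),
    pairing x (bracket a b x + bracket b a x) c =
      2 * ((1 / 2) * dirDeriv (fun y => pairing y (a y) (b y)) x (anchor x c))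
  anchor_pairing : ∀ (a b c : Sections EM FF V) (x : M),
    dirDeriv (fun y => pairing y (b y) (c y)) x (anchor x (a x)) =
      pairing x (bracket a b x) (c x) + pairing x (b x) (bracket a c x)

namespace CourantAlgebroid

variable {EM FF V} (C : CourantAlgebroid EM FF V)

/-- Exactness of `0 → T^*M → V → TM → 0`, where `ξ : T_xM → ℝ` is sent to the unique `v` with
`⟨v,w⟩ = ½ ξ(ρ(w))` for all `w`. (Injectivity of `T^*M → V` is the surjectivity of `ρ`.) -/
structure IsExact : Prop where
  anchor_surjective : ∀ x, Function.Surjective (C.anchor x)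
  ker_anchor : ∀ x (v : V x), C.anchor x v = 0 ↔
    ∃ ξ : TangentSpace 𝓘(ℝ, EM) x →ₗ[ℝ] ℝ, ∀ w, C.pairing x v w = (1 / 2) * ξ (C.anchor x w)

/-- The anchor on sections, `Γ(V) → Γ(TM)`. -/
def anchorSec : Sections EM FF V →ₗ[ℝ] VectorFields EM M where
  toFun a := ⟨fun x => C.anchor x (a x), C.anchor_smooth a⟩
  map_add' a b := by ext x; exact map_add (C.anchor x) (a x) (b x)
  map_smul' c a := by ext x; exact map_smul (C.anchor x) c (a x)

/-- The action `a, f ↦ ρ(a)(f)` of sections on functions. -/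
def act : Sections EM FF V →ₗ[ℝ] SmoothFun EM M →ₗ[ℝ] SmoothFun EM M :=
  fieldDeriv ∘ₗ C.anchorSec

lemma act_apply (a : Sections EM FF V) (f : SmoothFun EM M) (x : M) :
    C.act a f x = dirDeriv f x (C.anchor x (a x)) := rfl

/-- The pairing on sections, `a, b ↦ ⟨a,b⟩ ∈ C^∞(M)`. -/
def pairSec : Sections EM FF V →ₗ[ℝ] Sections EM FF V →ₗ[ℝ] SmoothFun EM M :=
  LinearMap.mk₂ ℝ (fun a b => ⟨fun x => C.pairing x (a x) (b x), C.pairing_smooth a b⟩)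
    (fun a b c => by ext x; exact LinearMap.map_add₂ (C.pairing x) (a x) (b x) (c x))
    (fun r a b => by ext x; exact LinearMap.map_smul₂ (C.pairing x) r (a x) (b x))
    (fun a b c => by ext x; exact map_add (C.pairing x (a x)) (b x) (c x))
    (fun r a b => by ext x; exact map_smul (C.pairing x (a x)) r (b x))

lemma pairSec_apply (a b : Sections EM FF V) (x : M) :
    C.pairSec a b x = C.pairing x (a x) (b x) := rfl

lemma bracket_funSmul (a b : Sections EM FF V) (f : SmoothFun EM M) :
    C.bracket a (funSmul EM FF V f b) =
      funSmul EM FF V (C.act a f) b + funSmul EM FF V f (C.bracket a b) := by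
  ext x; exact C.bracket_smul a b f x

lemma act_pairSec (a b c : Sections EM FF V) :
    C.act a (C.pairSec b c) = C.pairSec (C.bracket a b) c + C.pairSec b (C.bracket a c) := by
  ext x; exact C.anchor_pairing a b c x

lemma act_bracket_aux (a b c : Sections EM FF V) (f : SmoothFun EM M) :
    funSmul EM FF V (C.act (C.bracket a b) f) c =
      funSmul EM FF V (C.act a (C.act b f) - C.act b (C.act a f)) c := by
  have h := C.bracket_jacobi a b (funSmul EM FF V f c)
  simp only [bracket_funSmul, map_add, C.bracket_jacobi a b c] at h
  rw [map_sub, LinearMap.sub_apply]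
  have h' := sub_eq_zero.mpr h
  rw [← sub_eq_zero, ← neg_eq_zero, ← h']
  abel

/-- `ρ[a,b](f) = ρ(a)(ρ(b)(f)) - ρ(b)(ρ(a)(f))`. -/
lemma act_bracket (a b : Sections EM FF V) (f : SmoothFun EM M) :
    C.act (C.bracket a b) f = C.act a (C.act b f) - C.act b (C.act a f) := by
  ext x
  have key : ∀ c : Sections EM FF V, c x ≠ 0 →
      C.act (C.bracket a b) f x = (C.act a (C.act b f) - C.act b (C.act a f)) x := by
    intro c hc
    have h := congrArg (fun s : Sections EM FF V => s x) (C.act_bracket_aux a b c f)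
    exact smul_left_injective ℝ hc h
  have z : ∀ (c : Sections EM FF V) (g : SmoothFun EM M), c x = 0 → C.act c g x = 0 := by
    intro c g hc
    rw [act_apply, hc, map_zero]
    exact map_zero (mfderiv 𝓘(ℝ, EM) 𝓘(ℝ, ℝ) g x)
  by_cases ha : a x = 0
  · by_cases hb : b x = 0
    · by_cases hab : C.bracket a b x = 0
      · change _ = C.act a (C.act b f) x - C.act b (C.act a f) x
        rw [z _ _ ha, z _ _ hb, z _ _ hab, sub_zero]
      · exact key _ hab
    · exact key _ hb
  · exact key _ ha

end CourantAlgebroid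

variable {EM FF V}

/-- The smooth section `x ↦ J_x (a x)`, as a map on sections. -/
def endoSec (J : ∀ x, V x →ₗ[ℝ] V x)
    (hJ : ∀ a : Sections EM FF V, ContMDiff 𝓘(ℝ, EM) (𝓘(ℝ, EM).prod 𝓘(ℝ, FF)) ∞
      (fun x => (⟨x, J x (a x)⟩ : Bundle.TotalSpace FF V))) :
    Sections EM FF V →ₗ[ℝ] Sections EM FF V where
  toFun a := ⟨fun x => J x (a x), hJ a⟩
  map_add' a b := by ext x; exact map_add (J x) (a x) (b x)
  map_smul' c a := by ext x; exact map_smul (J x) c (a x)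

/-- A generalized complex structure on a Courant algebroid: a smooth orthogonal bundle
endomorphism `J` with `J² = -1` such that the sections of the `+i`-eigenbundle in the
complexification are closed under the (complex bilinearly extended) Dorfman bracket. -/
structure GeneralizedComplexStructure (C : CourantAlgebroid EM FF V) where
  J : ∀ x, V x →ₗ[ℝ] V x
  smooth : ∀ a : Sections EM FF V, ContMDiff 𝓘(ℝ, EM) (𝓘(ℝ, EM).prod 𝓘(ℝ, FF)) ∞
    (fun x => (⟨x, J x (a x)⟩ : Bundle.TotalSpace FF V))
  sq : ∀ x v, J x (J x v) = -v
  orthogonal : ∀ x v w, C.pairing x (J x v) (J x w) = C.pairing x v w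
  integrable : ∀ a ∈ Module.End.eigenspace ((endoSec J smooth).baseChange ℂ) Complex.I,
    ∀ b ∈ Module.End.eigenspace ((endoSec J smooth).baseChange ℂ) Complex.I,
      complexify₂ C.bracket a b ∈
        Module.End.eigenspace ((endoSec J smooth).baseChange ℂ) Complex.I

end Courant

/-! ### The base and the fibre bundle -/

/-- A complex structure on a smooth manifold `B`: a smooth endomorphism `J` of `TB` with
`J² = -1` which near every point is multiplication by `i` in suitable smooth complex
coordinates `φ = (φ₁, …, φₙ)`. -/
structure ComplexStructure (EB : Type*) [NormedAddCommGroup EB] [NormedSpace ℝ EB]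
    (B : Type*) [TopologicalSpace B] [ChartedSpace EB B] [IsManifold 𝓘(ℝ, EB) ∞ B] where
  J : ∀ b : B, TangentSpace 𝓘(ℝ, EB) b →ₗ[ℝ] TangentSpace 𝓘(ℝ, EB) b
  smooth : ∀ X : VectorFields EB B, ContMDiff 𝓘(ℝ, EB) 𝓘(ℝ, EB).tangent ∞
    (fun b => (⟨b, J b (X b)⟩ : TangentBundle 𝓘(ℝ, EB) B))
  sq : ∀ b v, J b (J b v) = -v
  exists_coordinates : ∀ b : B, ∃ (n : ℕ) (U : Set B) (φ : B → (Fin n → ℂ)),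
    IsOpen U ∧ b ∈ U ∧ ContMDiffOn 𝓘(ℝ, EB) 𝓘(ℝ, Fin n → ℂ) ∞ φ U ∧
      ∀ y ∈ U, ∃ T : EB →L[ℝ] (Fin n → ℂ), HasMFDerivAt 𝓘(ℝ, EB) 𝓘(ℝ, Fin n → ℂ) φ y T ∧
        Function.Bijective T ∧ ∀ v : EB, T (J y v) = Complex.I • T v

/-- The vector field `IX`. -/
def ComplexStructure.onFields {EB : Type*} [NormedAddCommGroup EB] [NormedSpace ℝ EB]
    {B : Type*} [TopologicalSpace B] [ChartedSpace EB B] [IsManifold 𝓘(ℝ, EB) ∞ B]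
    (I : ComplexStructure EB B) : VectorFields EB B →ₗ[ℝ] VectorFields EB B :=
  endoSec I.J I.smooth

/-- `p : M → B` is a smooth locally trivial fibre bundle with typical fibre `M₀`. -/
structure IsSmoothFiberBundle (EM EB E₀ : Type*) [NormedAddCommGroup EM] [NormedSpace ℝ EM]
    [NormedAddCommGroup EB] [NormedSpace ℝ EB] [NormedAddCommGroup E₀] [NormedSpace ℝ E₀]
    {M B : Type*} (M₀ : Type*) [TopologicalSpace M] [ChartedSpace EM M]
    [TopologicalSpace B] [ChartedSpace EB B] [TopologicalSpace M₀] [ChartedSpace E₀ M₀]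
    (p : M → B) : Prop where
  smooth : ContMDiff 𝓘(ℝ, EM) 𝓘(ℝ, EB) ∞ p
  locally_trivial : ∀ b : B, ∃ e : Bundle.Trivialization M₀ p, b ∈ e.baseSet ∧
    ContMDiffOn 𝓘(ℝ, EM) (𝓘(ℝ, EB).prod 𝓘(ℝ, E₀)) ∞ e e.source ∧
    ContMDiffOn (𝓘(ℝ, EB).prod 𝓘(ℝ, E₀)) 𝓘(ℝ, EM) ∞ e.toOpenPartialHomeomorph.symm e.target

section Extension

variable {EM : Type*} [NormedAddCommGroup EM] [NormedSpace ℝ EM] [FiniteDimensional ℝ EM]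
  {M : Type*} [TopologicalSpace M] [ChartedSpace EM M] [IsManifold 𝓘(ℝ, EM) ∞ M]
  [T2Space M] [SigmaCompactSpace M]
  {FF : Type*} [NormedAddCommGroup FF] [NormedSpace ℝ FF]
  {V : M → Type*} [TopologicalSpace (Bundle.TotalSpace FF V)]
  [∀ x, AddCommGroup (V x)] [∀ x, Module ℝ (V x)] [∀ x, TopologicalSpace (V x)]
  [FiberBundle FF V] [VectorBundle ℝ FF V]

open Filter Topology

/-- A smooth section near `x` that takes values in `A` extends, keeping its value at `x`, to a
global smooth section of `A`. -/
lemma exists_section_of_local (A : ∀ y, Submodule ℝ (V y)) (x : M) (s : ∀ y, V y) (U : Set M)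
    (hU : U ∈ 𝓝 x)
    (hs : ContMDiffOn 𝓘(ℝ, EM) (𝓘(ℝ, EM).prod 𝓘(ℝ, FF)) ∞
      (fun y => (⟨y, s y⟩ : Bundle.TotalSpace FF V)) U)
    (hA : ∀ y ∈ U, s y ∈ A y) :
    ∃ c : Sections EM FF V, (∀ y, c y ∈ A y) ∧ c x = s x := by
  obtain ⟨c, hc⟩ := exists_contMDiffSection_forall_mem_convex_of_local (n := (⊤ : ℕ∞))
    𝓘(ℝ, EM) V
    (fun y => {v | v ∈ A y ∧ (y = x → v = s y)})
    (fun y => by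
      intro v hv w hw a b ha hb hab
      refine ⟨(A y).add_mem ((A y).smul_mem _ hv.1) ((A y).smul_mem _ hw.1), fun h => ?_⟩
      rw [hv.2 h, hw.2 h, ← add_smul, hab, one_smul])
    (fun x₀ => by
      by_cases h : x₀ = x
      · subst h
        exact ⟨U, hU, s, hs, fun y hy => ⟨hA y hy, fun _ => rfl⟩⟩
      · refine ⟨{x}ᶜ, isOpen_compl_singleton.mem_nhds h, fun y => 0,
          ((Bundle.contMDiff_zeroSection ℝ V).of_le le_top).contMDiffOn, fun y hy => ?_⟩
        exact ⟨(A y).zero_mem, fun h' => absurd h' hy⟩)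
  exact ⟨c, fun y => (hc y).1, (hc x).2 rfl⟩

lemma exists_section_through [ContMDiffVectorBundle ∞ FF V 𝓘(ℝ, EM)] (x : M) (v : V x) :
    ∃ c : Sections EM FF V, c x = v := by
  obtain ⟨U, hU, hs⟩ := FiberBundle.exists_contMDiffOn_extend (k := ∞) 𝓘(ℝ, EM) FF v
  obtain ⟨c, -, hc⟩ := exists_section_of_local (fun _ => ⊤) x _ U hU hs (fun _ _ => trivial)
  exact ⟨c, hc.trans (by simp)⟩

set_option linter.unusedSectionVars false in
/-- Globally defined functions whose differentials separate tangent vectors near `b`. -/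
lemma exists_local_immersion (b : M) :
    ∃ G : M → EM, ContMDiff 𝓘(ℝ, EM) 𝓘(ℝ, EM) ∞ G ∧
      ∀ᶠ y in 𝓝 b, Function.Injective (mfderiv 𝓘(ℝ, EM) 𝓘(ℝ, EM) G y) := by
  obtain ⟨f⟩ : Nonempty (SmoothBumpFunction 𝓘(ℝ, EM) b) := inferInstance
  refine ⟨fun y => f y • extChartAt 𝓘(ℝ, EM) b y, f.contMDiff_smul contMDiffOn_extChartAt, ?_⟩
  have h1 := f.eventuallyEq_one.eventuallyEq_nhds
  have h2 : (chartAt EM b).source ∈ 𝓝 b := (chartAt EM b).open_source.mem_nhds (mem_chart_source _ b)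
  filter_upwards [h1, h2] with y hy hy'
  have h3 : (fun y => f y • extChartAt 𝓘(ℝ, EM) b y) =ᶠ[𝓝 y] extChartAt 𝓘(ℝ, EM) b := by
    filter_upwards [hy] with z hz
    simp [hz]
  rw [h3.mfderiv_eq]
  exact (isInvertible_mfderiv_extChartAt (by simpa using hy')).injective

end Extension

section Submersion

variable {EM EB E₀ : Type*} [NormedAddCommGroup EM] [NormedSpace ℝ EM]
    [NormedAddCommGroup EB] [NormedSpace ℝ EB] [NormedAddCommGroup E₀] [NormedSpace ℝ E₀]
    {M B M₀ : Type*} [TopologicalSpace M] [ChartedSpace EM M]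
    [TopologicalSpace B] [ChartedSpace EB B] [TopologicalSpace M₀] [ChartedSpace E₀ M₀]
    {p : M → B}

lemma IsSmoothFiberBundle.mfderiv_surjective (hp : IsSmoothFiberBundle EM EB E₀ M₀ p) (x : M) :
    Function.Surjective (mfderiv 𝓘(ℝ, EM) 𝓘(ℝ, EB) p x) := by
  obtain ⟨e, he, -, hs⟩ := hp.locally_trivial (p x)
  let m : M₀ := (e x).2
  have hx : x ∈ e.source := e.mem_source.mpr he
  have hex : e x = (p x, m) := Prod.ext (e.coe_fst hx) rfl
  have htgt : (p x, m) ∈ e.target := hex ▸ e.map_source hx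
  have hsym : e.toOpenPartialHomeomorph.symm (p x, m) = x := by
    rw [← hex]; exact e.left_inv hx
  let σ : B → M := fun y => e.toOpenPartialHomeomorph.symm (y, m)
  have hσx : σ (p x) = x := hsym
  have h1 : MDifferentiableAt (𝓘(ℝ, EB).prod 𝓘(ℝ, E₀)) 𝓘(ℝ, EM)
      e.toOpenPartialHomeomorph.symm (p x, m) :=
    ((hs _ htgt).contMDiffAt (e.open_target.mem_nhds htgt)).mdifferentiableAt (by simp)
  have h2 : MDifferentiableAt 𝓘(ℝ, EB) (𝓘(ℝ, EB).prod 𝓘(ℝ, E₀)) (fun y : B => (y, m)) (p x) :=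
    mdifferentiableAt_id.prodMk mdifferentiableAt_const
  have h3 : MDifferentiableAt 𝓘(ℝ, EB) 𝓘(ℝ, EM) σ (p x) := h1.comp (p x) h2
  have h4 : ∀ y, y = x → HasMFDerivAt 𝓘(ℝ, EM) 𝓘(ℝ, EB) p y
      (mfderiv 𝓘(ℝ, EM) 𝓘(ℝ, EB) p x : EM →L[ℝ] EB) := by
    rintro _ rfl
    exact (hp.smooth.mdifferentiable (by simp) _).hasMFDerivAt
  have h5 : p ∘ σ =ᶠ[nhds (p x)] id := by
    filter_upwards [e.open_baseSet.mem_nhds he] with y hy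
    exact e.proj_symm_apply (e.mem_target.mpr hy)
  have h6 := (h4 _ hσx).comp (p x) h3.hasMFDerivAt
  have h7 : HasMFDerivAt 𝓘(ℝ, EB) 𝓘(ℝ, EB) (p ∘ σ) (p x) (ContinuousLinearMap.id ℝ EB) :=
    (hasMFDerivAt_id (I := 𝓘(ℝ, EB)) (p x)).congr_of_eventuallyEq h5
  have h8 := hasMFDerivAt_unique h6 h7
  intro v
  exact ⟨(mfderiv 𝓘(ℝ, EB) 𝓘(ℝ, EM) σ (p x) : EB →L[ℝ] EM) v,
    congrArg (fun T : EB →L[ℝ] EB => T v) h8⟩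

end Submersion
/-! ### Holomorphic families and the fiberwise reduction -/

/-- A holomorphic family of generalized complex structures: a smooth fibre bundle `p : M → B`,
an exact Courant algebroid on a vector bundle `V → M`, a generalized complex structure `J` on it
and a complex structure `I` on `B`, such that `A = ker (p_* ∘ ρ)` is `J`-invariant and the
complex structure induced by `J` on `V / A ≅ p^* TB` is `-p^* I`. -/
structure HolomorphicFamily (EM EB E₀ : Type*)
    [NormedAddCommGroup EM] [NormedSpace ℝ EM] [NormedAddCommGroup EB] [NormedSpace ℝ EB]
    [NormedAddCommGroup E₀] [NormedSpace ℝ E₀]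
    (M B M₀ : Type*) [TopologicalSpace M] [ChartedSpace EM M] [IsManifold 𝓘(ℝ, EM) ∞ M]
    [TopologicalSpace B] [ChartedSpace EB B] [IsManifold 𝓘(ℝ, EB) ∞ B]
    [TopologicalSpace M₀] [ChartedSpace E₀ M₀]
    (FF : Type*) [NormedAddCommGroup FF] [NormedSpace ℝ FF]
    (V : M → Type*) [TopologicalSpace (Bundle.TotalSpace FF V)]
    [∀ x, AddCommGroup (V x)] [∀ x, Module ℝ (V x)] [∀ x, TopologicalSpace (V x)]
    [FiberBundle FF V] [VectorBundle ℝ FF V] where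
  proj : M → B
  isFiberBundle : IsSmoothFiberBundle EM EB E₀ M₀ proj
  courant : CourantAlgebroid EM FF V
  isExact : courant.IsExact
  gcs : GeneralizedComplexStructure courant
  baseStructure : ComplexStructure EB B
  invariant : ∀ x (v : V x),
    mfderiv 𝓘(ℝ, EM) 𝓘(ℝ, EB) proj x (courant.anchor x v) = 0 →
      mfderiv 𝓘(ℝ, EM) 𝓘(ℝ, EB) proj x (courant.anchor x (gcs.J x v)) = 0
  induced : ∀ x (v : V x),
    mfderiv 𝓘(ℝ, EM) 𝓘(ℝ, EB) proj x (courant.anchor x (gcs.J x v)) =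
      -baseStructure.J (proj x) (mfderiv 𝓘(ℝ, EM) 𝓘(ℝ, EB) proj x (courant.anchor x v))

namespace HolomorphicFamily

variable {EM EB E₀ : Type*}
    [NormedAddCommGroup EM] [NormedSpace ℝ EM] [NormedAddCommGroup EB] [NormedSpace ℝ EB]
    [NormedAddCommGroup E₀] [NormedSpace ℝ E₀]
    {M B M₀ : Type*} [TopologicalSpace M] [ChartedSpace EM M] [IsManifold 𝓘(ℝ, EM) ∞ M]
    [TopologicalSpace B] [ChartedSpace EB B] [IsManifold 𝓘(ℝ, EB) ∞ B]
    [TopologicalSpace M₀] [ChartedSpace E₀ M₀]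
    {FF : Type*} [NormedAddCommGroup FF] [NormedSpace ℝ FF]
    {V : M → Type*} [TopologicalSpace (Bundle.TotalSpace FF V)]
    [∀ x, AddCommGroup (V x)] [∀ x, Module ℝ (V x)] [∀ x, TopologicalSpace (V x)]
    [FiberBundle FF V] [VectorBundle ℝ FF V]
    (H : HolomorphicFamily EM EB E₀ M B M₀ FF V)

/-- The composition `p_* ∘ ρ` at `x`. -/
def projAnchor (x : M) : V x →ₗ[ℝ] TangentSpace 𝓘(ℝ, EB) (H.proj x) :=
  (mfderiv 𝓘(ℝ, EM) 𝓘(ℝ, EB) H.proj x).toLinearMap ∘ₗ H.courant.anchor x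

/-- The fibre at `x` of the subbundle `A = ker (p_* ∘ ρ)`. -/
def A (x : M) : Submodule ℝ (V x) := LinearMap.ker (H.projAnchor x)

/-- The fibre at `x` of `A^⊥`, the annihilator of `A` with respect to the pairing. -/
def Aperp (x : M) : Submodule ℝ (V x) := (H.courant.pairing x).orthogonal (H.A x)

/-- The sections `Γ(A)`. -/
def secA : Submodule ℝ (Sections EM FF V) where
  carrier := {a | ∀ x, a x ∈ H.A x}
  add_mem' ha hb x := (H.A x).add_mem (ha x) (hb x)
  zero_mem' x := (H.A x).zero_mem
  smul_mem' c _ ha x := (H.A x).smul_mem c (ha x)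

/-- The sections `Γ(A^⊥)`. -/
def secAperp : Submodule ℝ (Sections EM FF V) where
  carrier := {a | ∀ x, a x ∈ H.Aperp x}
  add_mem' ha hb x := (H.Aperp x).add_mem (ha x) (hb x)
  zero_mem' x := (H.Aperp x).zero_mem
  smul_mem' c _ ha x := (H.Aperp x).smul_mem c (ha x)

/-- `z ∈ Γ(V)` is a lift of the vector field `Z` on `B`: `p_*(ρ(z(x))) = Z(p(x))` for all `x`. -/
def IsLift (z : Sections EM FF V) (Z : VectorFields EB B) : Prop :=
  ∀ x, H.projAnchor x (z x) = Z (H.proj x)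

/-- The pullback `p^* g` of a function on `B`. -/
def pullback (g : SmoothFun EB B) : SmoothFun EM M :=
  ⟨fun x => g (H.proj x), g.contMDiff.comp H.isFiberBundle.smooth⟩

lemma dirDeriv_pullback (g : SmoothFun EB B) (x : M) (v : TangentSpace 𝓘(ℝ, EM) x) :
    dirDeriv (H.pullback g) x v =
      dirDeriv g (H.proj x) (mfderiv 𝓘(ℝ, EM) 𝓘(ℝ, EB) H.proj x v) :=
  mfderiv_comp_apply x (g.contMDiff.mdifferentiable (by simp) _)
    (H.isFiberBundle.smooth.mdifferentiable (by simp) x) v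

lemma act_pullback_apply (a : Sections EM FF V) (g : SmoothFun EB B) (x : M) :
    H.courant.act a (H.pullback g) x = dirDeriv g (H.proj x) (H.projAnchor x (a x)) :=
  H.dirDeriv_pullback g x _

lemma IsLift.act_pullback {H : HolomorphicFamily EM EB E₀ M B M₀ FF V}
    {z : Sections EM FF V} {Z : VectorFields EB B} (h : H.IsLift z Z) (g : SmoothFun EB B) :
    H.courant.act z (H.pullback g) = H.pullback (fieldDeriv Z g) := by
  ext x
  rw [act_pullback_apply, h x]
  rfl

lemma isLift_zero {a : Sections EM FF V} (ha : a ∈ H.secA) : H.IsLift a 0 := ha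

lemma act_pullback_eq_zero {a : Sections EM FF V} (ha : a ∈ H.secA) (g : SmoothFun EB B) :
    H.courant.act a (H.pullback g) = 0 := by
  ext x
  rw [act_pullback_apply, show H.projAnchor x (a x) = 0 from ha x]
  exact map_zero (mfderiv 𝓘(ℝ, EB) 𝓘(ℝ, ℝ) g (H.proj x))

section FiniteDim

variable [FiniteDimensional ℝ EB] [T2Space B] [SigmaCompactSpace B]

/-- Finitely many functions on `B` whose differentials separate tangent vectors near `b`. -/
lemma exists_coordinate_functions (b : B) :
    ∃ g : Fin (Module.finrank ℝ EB) → SmoothFun EB B,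
      (∀ᶠ y in nhds b, ∀ v : TangentSpace 𝓘(ℝ, EB) y, (∀ i, dirDeriv (g i) y v = 0) → v = 0) ∧
      ∃ e : Fin (Module.finrank ℝ EB) → TangentSpace 𝓘(ℝ, EB) b,
        ∀ i j, dirDeriv (g i) b (e j) = if i = j then 1 else 0 := by
  obtain ⟨G, hG, hinj⟩ := exists_local_immersion (EM := EB) b
  let β := Module.finBasis ℝ EB
  let L : Fin (Module.finrank ℝ EB) → EB →L[ℝ] ℝ := fun i => (β.coord i).toContinuousLinearMap
  have hd : ∀ i y (v : TangentSpace 𝓘(ℝ, EB) y), dirDeriv (fun z => L i (G z)) y v =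
      β.coord i (mfderiv 𝓘(ℝ, EB) 𝓘(ℝ, EB) G y v : EB) := by
    intro i y v
    have h1 := ((L i).hasMFDerivAt (x := G y)).comp y
      (hG.mdifferentiable (by simp) y).hasMFDerivAt
    exact congrArg (fun T : EB →L[ℝ] ℝ => T v) h1.mfderiv
  refine ⟨fun i => ⟨fun y => L i (G y), (L i).contMDiff.comp hG⟩, ?_, ?_⟩
  · filter_upwards [hinj] with y hy v hv
    refine hy ?_
    have h0 : (mfderiv 𝓘(ℝ, EB) 𝓘(ℝ, EB) G y v : EB) = (0 : EB) := by
      refine β.ext_elem fun i => ?_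
      exact ((hd i y v).symm.trans (hv i)).trans (by simp)
    exact h0.trans (map_zero (mfderiv 𝓘(ℝ, EB) 𝓘(ℝ, EB) G y)).symm
  · let T : EB →ₗ[ℝ] EB := (mfderiv 𝓘(ℝ, EB) 𝓘(ℝ, EB) G b : EB →L[ℝ] EB).toLinearMap
    have hs : Function.Surjective T := LinearMap.injective_iff_surjective.mp hinj.self_of_nhds
    choose e he using fun j => hs (β j)
    refine ⟨e, fun i j => (hd i b (e j)).trans ?_⟩
    change β.coord i (T (e j)) = _
    rw [he j]
    simp [Finsupp.single_apply, eq_comm]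

lemma mem_secA_of_act {a : Sections EM FF V}
    (ha : ∀ g : SmoothFun EB B, H.courant.act a (H.pullback g) = 0) : a ∈ H.secA := by
  intro x
  obtain ⟨g, hg, -⟩ := exists_coordinate_functions (EB := EB) (H.proj x)
  refine hg.self_of_nhds _ fun i => ?_
  rw [← act_pullback_apply, ha]
  rfl

/-- If `z` lifts a vector field on `B` then `[z, Γ(A)] ⊆ Γ(A)`. -/
lemma bracket_mem_secA {z : Sections EM FF V} {Z : VectorFields EB B} (hz : H.IsLift z Z)
    {a : Sections EM FF V} (ha : a ∈ H.secA) : H.courant.bracket z a ∈ H.secA := by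
  refine H.mem_secA_of_act fun g => ?_
  rw [CourantAlgebroid.act_bracket, H.act_pullback_eq_zero ha, hz.act_pullback,
    H.act_pullback_eq_zero ha, map_zero, sub_zero]

end FiniteDim

lemma act_funSmul (f : SmoothFun EM M) (a : Sections EM FF V) (g : SmoothFun EM M) :
    H.courant.act (funSmul EM FF V f a) g = f * H.courant.act a g := by
  ext x
  change dirDeriv g x (H.courant.anchor x (f x • a x)) = _
  rw [map_smul]
  exact map_smul (mfderiv 𝓘(ℝ, EM) 𝓘(ℝ, ℝ) g x) _ _

lemma projAnchor_surjective (x : M) : Function.Surjective (H.projAnchor x) :=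
  (H.isFiberBundle.mfderiv_surjective x).comp (H.isExact.anchor_surjective x)

/-- Since `A` is a subbundle, every vector in `A` is a value of a section of `A`. -/
lemma exists_secA_through [FiniteDimensional ℝ EM] [T2Space M] [SigmaCompactSpace M]
    [FiniteDimensional ℝ EB] [T2Space B] [SigmaCompactSpace B] [ContMDiffVectorBundle ∞ FF V 𝓘(ℝ, EM)]
    (x : M) (w : V x) (hw : w ∈ H.A x) : ∃ c ∈ H.secA, c x = w := by
  obtain ⟨g, hg, e, he⟩ := exists_coordinate_functions (EB := EB) (H.proj x)
  choose v hv using fun j => H.projAnchor_surjective x (e j)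
  choose z hz using fun j => exists_section_through (EM := EM) (FF := FF) x (v j)
  obtain ⟨c₀, hc₀⟩ := exists_section_through (EM := EM) (FF := FF) x w
  let m : Matrix (Fin (Module.finrank ℝ EB)) (Fin (Module.finrank ℝ EB)) (SmoothFun EM M) :=
    fun i j => H.courant.act (z j) (H.pullback (g i))
  let u : Fin (Module.finrank ℝ EB) → SmoothFun EM M :=
    fun i => H.courant.act c₀ (H.pullback (g i))
  let c₁ : Sections EM FF V := funSmul EM FF V m.det c₀ -
    ∑ j, funSmul EM FF V ((m.adjugate.mulVec u) j) (z j)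
  have h1 : ∀ i, H.courant.act c₁ (H.pullback (g i)) = 0 := by
    intro i
    simp only [c₁, map_sub, map_sum, LinearMap.sub_apply, LinearMap.sum_apply, act_funSmul]
    have h2 : m.mulVec (m.adjugate.mulVec u) i = m.det * u i := by
      rw [Matrix.mulVec_mulVec, Matrix.mul_adjugate, Matrix.smul_mulVec, Matrix.one_mulVec]
      rfl
    rw [sub_eq_zero]
    refine h2.symm.trans ?_
    change ∑ j, m i j * _ = _
    exact Finset.sum_congr rfl fun j _ => mul_comm _ _
  have h2 : ∀ i, u i x = 0 := by
    intro i
    change H.courant.act c₀ (H.pullback (g i)) x = 0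
    rw [act_pullback_apply, hc₀, show H.projAnchor x w = 0 from hw]
    exact map_zero (mfderiv 𝓘(ℝ, EB) 𝓘(ℝ, ℝ) (g i) (H.proj x))
  have h3 : (ContMDiffMap.evalRingHom x : SmoothFun EM M →+* ℝ).mapMatrix m = 1 := by
    ext i j
    change H.courant.act (z j) (H.pullback (g i)) x = _
    rw [act_pullback_apply, hz, hv, he, Matrix.one_apply]
  have h4 : m.det x = 1 := by
    change (ContMDiffMap.evalRingHom x : SmoothFun EM M →+* ℝ) m.det = 1
    rw [RingHom.map_det, h3, Matrix.det_one]
  have h5 : ∀ j, (m.adjugate.mulVec u) j x = 0 := by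
    intro j
    change (ContMDiffMap.evalRingHom x : SmoothFun EM M →+* ℝ) (∑ i, m.adjugate j i * u i) = 0
    rw [map_sum]
    refine Finset.sum_eq_zero fun i _ => ?_
    rw [map_mul]
    exact mul_eq_zero_of_right _ (h2 i)
  have h6 : c₁ x = w := by
    have h7 : ∀ (s : Finset (Fin (Module.finrank ℝ EB))) (f : _ → Sections EM FF V),
        (∑ j ∈ s, f j) x = ∑ j ∈ s, f j x := by
      intro s f
      change ContMDiffSection.coeAddHom 𝓘(ℝ, EM) FF ∞ V (∑ j ∈ s, f j) x = _
      rw [map_sum, Finset.sum_apply]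
      rfl
    change m.det x • c₀ x - (∑ j, funSmul EM FF V ((m.adjugate.mulVec u) j) (z j)) x = w
    rw [h7, h4, one_smul, hc₀]
    simp [h5]
  obtain ⟨c, hcA, hc⟩ := exists_section_of_local (EM := EM) (FF := FF) H.A x c₁ _
    (H.isFiberBundle.smooth.continuous.continuousAt.eventually hg)
    c₁.contMDiff.contMDiffOn (fun y hy => by
      refine hy _ fun i => ?_
      rw [← act_pullback_apply, h1]
      rfl)
  exact ⟨c, hcA, hc.trans h6⟩

/-! #### The fiberwise reduction `E = A / A^⊥`: sections, pairing, anchor, complex structure -/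

lemma pairSec_eq_zero {q a : Sections EM FF V} (hq : q ∈ H.secAperp) (ha : a ∈ H.secA) :
    H.courant.pairSec q a = 0 := by
  ext x
  exact ((H.courant.pairing_symm x).eq (a x) (q x)).symm.trans (hq x (a x) (ha x))

lemma pairSec_symm (a b : Sections EM FF V) :
    H.courant.pairSec a b = H.courant.pairSec b a := by
  ext x
  exact (H.courant.pairing_symm x).eq (a x) (b x)

lemma anchor_eq_zero_of_mem_Aperp (x : M) {v : V x} (hv : v ∈ H.Aperp x) :
    H.courant.anchor x v = 0 := by
  obtain ⟨s, hs⟩ := (H.courant.anchor x).exists_rightInverse_of_surjective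
    (LinearMap.range_eq_top.mpr (H.isExact.anchor_surjective x))
  refine (H.isExact.ker_anchor x v).mpr ⟨(2 : ℝ) • (H.courant.pairing x v ∘ₗ s), fun w => ?_⟩
  have h1 : w - s (H.courant.anchor x w) ∈ H.A x := by
    change mfderiv 𝓘(ℝ, EM) 𝓘(ℝ, EB) H.proj x (H.courant.anchor x _) = 0
    have h2 : H.courant.anchor x (s (H.courant.anchor x w)) = H.courant.anchor x w :=
      LinearMap.congr_fun hs _
    rw [map_sub, h2, sub_self, map_zero]
  have h3 : H.courant.pairing x v (w - s (H.courant.anchor x w)) = 0 :=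
    ((H.courant.pairing_symm x).eq _ _).symm.trans (hv _ h1)
  rw [map_sub, sub_eq_zero] at h3
  rw [h3]
  simp

lemma secAperp_le_secA : H.secAperp ≤ H.secA := by
  intro q hq x
  change mfderiv 𝓘(ℝ, EM) 𝓘(ℝ, EB) H.proj x (H.courant.anchor x _) = 0
  rw [H.anchor_eq_zero_of_mem_Aperp x (hq x), map_zero]

/-- The sections `Γ(E)` of the fiberwise reduction `E = A / A^⊥`, a quotient of vector bundles:
`Γ(E) = Γ(A) / Γ(A^⊥)`. -/
abbrev SecE : Type _ := H.secA ⧸ H.secAperp.submoduleOf H.secA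

/-- The class in `Γ(E)` of a section of `A`. -/
abbrev toE : H.secA →ₗ[ℝ] H.SecE := (H.secAperp.submoduleOf H.secA).mkQ

/-- The pairing on `Γ(E)`. -/
def pairE : H.SecE →ₗ[ℝ] H.SecE →ₗ[ℝ] SmoothFun EM M :=
  liftQ₂ _ _ (H.courant.pairSec.compl₁₂ H.secA.subtype H.secA.subtype)
    (fun _ hq a => H.pairSec_eq_zero hq a.2)
    (fun a _ hq => (H.pairSec_symm _ _).trans (H.pairSec_eq_zero hq a.2))

/-- The anchor of `E`, as an action of `Γ(E)` on functions: `e, f ↦ ρ(e)(f)`. -/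
def actE : H.SecE →ₗ[ℝ] SmoothFun EM M →ₗ[ℝ] SmoothFun EM M :=
  (H.secAperp.submoduleOf H.secA).liftQ (H.courant.act ∘ₗ H.secA.subtype) fun q hq => by
    ext f x
    change dirDeriv f x (H.courant.anchor x ((q : Sections EM FF V) x)) = 0
    rw [show H.courant.anchor x ((q : Sections EM FF V) x) = 0 from
      H.anchor_eq_zero_of_mem_Aperp x (hq x)]
    exact map_zero (mfderiv 𝓘(ℝ, EM) 𝓘(ℝ, ℝ) f x)

/-- The multiplication of sections of `E` by functions. -/
def smulE : SmoothFun EM M →ₗ[ℝ] H.SecE →ₗ[ℝ] H.SecE where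
  toFun f := Submodule.mapQ _ _
    ((funSmul EM FF V f).restrict fun a (ha : a ∈ H.secA) x => (H.A x).smul_mem (f x) (ha x))
    fun q hq x => (H.Aperp x).smul_mem (f x) (hq x)
  map_add' f g := by
    refine Submodule.linearMap_qext _ (LinearMap.ext fun a => congrArg H.toE (Subtype.ext ?_))
    exact LinearMap.map_add₂ (funSmul EM FF V) f g a
  map_smul' r f := by
    refine Submodule.linearMap_qext _ (LinearMap.ext fun a => congrArg H.toE (Subtype.ext ?_))
    exact LinearMap.map_smul₂ (funSmul EM FF V) r f a

/-- The complex structure of `V` on sections. -/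
abbrev Jsec : Sections EM FF V →ₗ[ℝ] Sections EM FF V := endoSec H.gcs.J H.gcs.smooth

/-- `J` on `Γ(A)`. -/
def JA : H.secA →ₗ[ℝ] H.secA :=
  H.Jsec.restrict fun _ ha x => H.invariant x _ (ha x)

lemma J_mem_Aperp (x : M) {v : V x} (hv : v ∈ H.Aperp x) : H.gcs.J x v ∈ H.Aperp x := by
  intro w hw
  have h := H.gcs.orthogonal x (H.gcs.J x w) v
  rw [H.gcs.sq, LinearMap.map_neg₂] at h
  exact neg_eq_zero.mp (h.trans (hv _ (H.invariant x w hw)))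

/-- The generalized complex structure induced on `E`, acting on sections. -/
def JE : H.SecE →ₗ[ℝ] H.SecE :=
  Submodule.mapQ _ _ H.JA fun _ hq x => H.J_mem_Aperp x (hq x)

/-! #### The complex Lie algebroid `L ⊆ E ⊗ ℂ`: sections, anchor and cochains -/

/-- Smooth complex functions `C^∞(M, ℂ) = C^∞(M) ⊗ ℂ`. -/
abbrev CFun (_ : HolomorphicFamily EM EB E₀ M B M₀ FF V) : Type _ := ℂ ⊗[ℝ] SmoothFun EM M

/-- Sections of `L`, the `+i`-eigenbundle of the induced structure on `E ⊗ ℂ`, as a subspace of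
`Γ(E ⊗ ℂ) = Γ(E) ⊗ ℂ`. -/
def secL : Submodule ℂ (ℂ ⊗[ℝ] H.SecE) :=
  Module.End.eigenspace (H.JE.baseChange ℂ) Complex.I

lemma mem_secL {a : ℂ ⊗[ℝ] H.SecE} : a ∈ H.secL ↔ H.JE.baseChange ℂ a = Complex.I • a :=
  Module.End.mem_eigenspace_iff

lemma smulE_JE (f : SmoothFun EM M) (a : H.SecE) : H.JE (H.smulE f a) = H.smulE f (H.JE a) := by
  obtain ⟨a, rfl⟩ := Submodule.mkQ_surjective _ a
  refine congrArg H.toE (Subtype.ext ?_)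
  ext x
  exact map_smul (H.gcs.J x) (f x) ((a : Sections EM FF V) x)

lemma smul_mem_secL (f : H.CFun) {a : ℂ ⊗[ℝ] H.SecE} (ha : a ∈ H.secL) :
    complexify₂ H.smulE f a ∈ H.secL := by
  have h : ∀ (f : ℂ ⊗[ℝ] SmoothFun EM M) (a : ℂ ⊗[ℝ] H.SecE), H.JE.baseChange ℂ
      (complexify₂ H.smulE f a) = complexify₂ H.smulE f (H.JE.baseChange ℂ a) := by
    intro f a
    induction f with
    | zero => simp
    | add f g hf hg => simp [hf, hg]
    | tmul z f =>
      induction a with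
      | zero => simp
      | add a b ha hb => simp [ha, hb]
      | tmul w a => simp [smulE_JE]
  rw [mem_secL] at ha ⊢
  rw [h, ha, map_smul]

/-- The multiplication of sections of `L` by complex functions. -/
def smulL (f : H.CFun) (a : H.secL) : H.secL :=
  ⟨complexify₂ H.smulE f a, H.smul_mem_secL f a.2⟩

/-- The anchor of `L`, as an action on complex functions. -/
def actL (a : H.secL) : H.CFun →ₗ[ℂ] H.CFun := complexify₂ H.actE a

/-- The complex bilinear pairing on `Γ(E ⊗ ℂ)`. -/
def pairC (a b : ℂ ⊗[ℝ] H.SecE) : H.CFun := complexify₂ H.pairE a b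

lemma bracket_swap_of_mem {q a : Sections EM FF V} (hq : q ∈ H.secAperp) (ha : a ∈ H.secA) :
    H.courant.bracket q a = -H.courant.bracket a q := by
  rw [← add_eq_zero_iff_eq_neg]
  ext x
  refine (H.courant.pairing_nondegenerate x).1 _ fun c => ?_
  refine (H.courant.bracket_add_swap q a x c).trans ?_
  have h : dirDeriv (H.courant.pairSec q a) x (H.courant.anchor x c) = 0 := by
    rw [H.pairSec_eq_zero hq ha]
    exact congrArg (fun T : EM →L[ℝ] ℝ => T (H.courant.anchor x c)) mfderiv_const
  change 2 * ((1 / 2) * dirDeriv (H.courant.pairSec q a) x (H.courant.anchor x c)) = 0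
  rw [h]
  simp

/-! #### Dorfman bracket and derivations of `E` -/

section Reduction

variable [FiniteDimensional ℝ EM] [T2Space M] [SigmaCompactSpace M]
  [FiniteDimensional ℝ EB] [T2Space B] [SigmaCompactSpace B]
  [ContMDiffVectorBundle ∞ FF V 𝓘(ℝ, EM)]

/-- If `z` lifts a vector field on `B` then `[z, Γ(A^⊥)] ⊆ Γ(A^⊥)`. -/
lemma bracket_mem_secAperp {z : Sections EM FF V} {Z : VectorFields EB B} (hz : H.IsLift z Z)
    {q : Sections EM FF V} (hq : q ∈ H.secAperp) : H.courant.bracket z q ∈ H.secAperp := by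
  intro x w hw
  obtain ⟨c, hc, rfl⟩ := H.exists_secA_through x w hw
  have h := H.courant.act_pairSec z c q
  rw [H.pairSec_symm c q, H.pairSec_eq_zero hq hc, map_zero,
    H.pairSec_symm (H.courant.bracket z c) q, H.pairSec_eq_zero hq (H.bracket_mem_secA hz hc),
    zero_add] at h
  exact (congrArg (fun f : SmoothFun EM M => f x) h).symm

/-- The action on `Γ(A)` of the inner derivation `[z, ·]`, for a lift `z` of a vector field. -/
def adA {z : Sections EM FF V} {Z : VectorFields EB B} (hz : H.IsLift z Z) :
    H.secA →ₗ[ℝ] H.secA :=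
  (H.courant.bracket z).restrict fun _ ha => H.bracket_mem_secA hz ha

/-- The derivation `D` of `E` induced by `[z, ·]`, for a lift `z` of a vector field on `B`. -/
def derivE {z : Sections EM FF V} {Z : VectorFields EB B} (hz : H.IsLift z Z) :
    H.SecE →ₗ[ℝ] H.SecE :=
  Submodule.mapQ _ _ (H.adA hz) fun _ hq => H.bracket_mem_secAperp hz hq

/-- The Dorfman bracket on `Γ(A)`. -/
def bracketA : H.secA →ₗ[ℝ] H.secA →ₗ[ℝ] H.secA :=
  LinearMap.mk₂ ℝ (fun a b => ⟨H.courant.bracket a b, H.bracket_mem_secA (H.isLift_zero a.2) b.2⟩)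
    (fun a b c => Subtype.ext (LinearMap.map_add₂ H.courant.bracket a b c))
    (fun r a b => Subtype.ext (LinearMap.map_smul₂ H.courant.bracket r a b))
    (fun a b c => Subtype.ext (map_add (H.courant.bracket a.1) b.1 c.1))
    (fun r a b => Subtype.ext (map_smul (H.courant.bracket a.1) r b.1))

/-- The Dorfman bracket on `Γ(E)`. -/
def bracketE : H.SecE →ₗ[ℝ] H.SecE →ₗ[ℝ] H.SecE :=
  liftQ₂ _ _ (H.bracketA.compr₂ H.toE)
    (fun q hq a => by
      refine (Submodule.Quotient.mk_eq_zero _).mpr ?_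
      change H.courant.bracket q a ∈ H.secAperp
      rw [show H.courant.bracket (q : Sections EM FF V) a = _ from H.bracket_swap_of_mem hq a.2]
      exact H.secAperp.neg_mem (H.bracket_mem_secAperp (H.isLift_zero a.2) hq))
    (fun a q hq => (Submodule.Quotient.mk_eq_zero _).mpr
      (H.bracket_mem_secAperp (H.isLift_zero a.2) hq))

/-! #### The Lie bracket of `L` and its cohomology -/

/-- `L` is closed under the bracket. -/
lemma bracket_mem_secL {a b : ℂ ⊗[ℝ] H.SecE} (ha : a ∈ H.secL) (hb : b ∈ H.secL) :
    complexify₂ H.bracketE a b ∈ H.secL := by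
  have hJ2 : ∀ a : ℂ ⊗[ℝ] H.secA, H.JA.baseChange ℂ (H.JA.baseChange ℂ a) = -a := by
    intro a
    induction a with
    | zero => simp
    | add a b ha hb => simp only [map_add, ha, hb]; abel
    | tmul w a =>
      have : H.JA (H.JA a) = -a := by
        ext x
        exact H.gcs.sq x _
      simp [this, TensorProduct.tmul_neg]
  have hJq : ∀ a : ℂ ⊗[ℝ] H.secA, H.JE.baseChange ℂ (H.toE.baseChange ℂ a) =
      H.toE.baseChange ℂ (H.JA.baseChange ℂ a) := by
    intro a
    induction a with
    | zero => simp
    | add a b ha hb => simp only [map_add, ha, hb]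
    | tmul w a => rfl
  have hJi : ∀ a : ℂ ⊗[ℝ] H.secA, H.Jsec.baseChange ℂ (H.secA.subtype.baseChange ℂ a) =
      H.secA.subtype.baseChange ℂ (H.JA.baseChange ℂ a) := by
    intro a
    induction a with
    | zero => simp
    | add a b ha hb => simp only [map_add, ha, hb]
    | tmul w a => rfl
  have hbq : ∀ a b : ℂ ⊗[ℝ] H.secA, complexify₂ H.bracketE (H.toE.baseChange ℂ a)
      (H.toE.baseChange ℂ b) = H.toE.baseChange ℂ (complexify₂ H.bracketA a b) := by
    intro a b
    induction a with
    | zero => simp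
    | add a a' ha hb => simp only [map_add, LinearMap.add_apply, ha, hb]
    | tmul w a =>
      induction b with
      | zero => simp
      | add b b' ha hb => simp only [map_add, ha, hb]
      | tmul w b => simp only [LinearMap.baseChange_tmul, complexify₂_tmul]; rfl
  have hbi : ∀ a b : ℂ ⊗[ℝ] H.secA, complexify₂ H.courant.bracket
      (H.secA.subtype.baseChange ℂ a) (H.secA.subtype.baseChange ℂ b) =
      H.secA.subtype.baseChange ℂ (complexify₂ H.bracketA a b) := by
    intro a b
    induction a with
    | zero => simp
    | add a a' ha hb => simp only [map_add, LinearMap.add_apply, ha, hb]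
    | tmul w a =>
      induction b with
      | zero => simp
      | add b b' ha hb => simp only [map_add, ha, hb]
      | tmul w b => simp only [LinearMap.baseChange_tmul, complexify₂_tmul]; rfl
  have hinj : Function.Injective (H.secA.subtype.baseChange ℂ) := by
    rw [LinearMap.baseChange_eq_ltensor]
    exact Module.Flat.lTensor_preserves_injective_linearMap _ H.secA.injective_subtype
  have hlift : ∀ a ∈ H.secL, ∃ c : ℂ ⊗[ℝ] H.secA,
      H.JA.baseChange ℂ c = Complex.I • c ∧ H.toE.baseChange ℂ c = a := by
    intro a ha
    obtain ⟨c, rfl⟩ : ∃ c, H.toE.baseChange ℂ c = a := by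
      have := LinearMap.lTensor_surjective ℂ (Submodule.mkQ_surjective
        (H.secAperp.submoduleOf H.secA))
      exact this a
    rw [mem_secL, hJq] at ha
    refine ⟨(1 / 2 : ℂ) • (c - Complex.I • H.JA.baseChange ℂ c), ?_, ?_⟩
    · simp only [map_smul, map_sub, hJ2, smul_sub, smul_smul, smul_neg]
      rw [mul_left_comm, Complex.I_mul_I]
      module
    · simp only [map_smul, map_sub, ha, smul_smul, Complex.I_mul_I]
      module
  obtain ⟨a', ha', rfl⟩ := hlift a ha
  obtain ⟨b', hb', rfl⟩ := hlift b hb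
  have h1 := H.gcs.integrable (H.secA.subtype.baseChange ℂ a')
    (Module.End.mem_eigenspace_iff.mpr (by rw [hJi, ha', map_smul]))
    (H.secA.subtype.baseChange ℂ b')
    (Module.End.mem_eigenspace_iff.mpr (by rw [hJi, hb', map_smul]))
  rw [Module.End.mem_eigenspace_iff, hbi, hJi, ← map_smul] at h1
  rw [mem_secL, hbq, hJq, hinj h1, map_smul]

/-- The Lie bracket on `Γ(L)`. -/
def bracketL (a b : H.secL) : H.secL :=
  ⟨complexify₂ H.bracketE a b, H.bracket_mem_secL a.2 b.2⟩

/-- The complex Lie algebroid `L`. -/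
def lieL : LieAlgebroidOps H.CFun H.secL where
  smul := H.smulL
  act := H.actL
  bracket := H.bracketL

/-- The second Lie algebroid cohomology `H²(L)`. -/
abbrev H2 : Type _ := H.lieL.H2

/-- `κ` is the class in `H²(L)` of `a, b ↦ ⟨Da, b⟩`, where `D` is the derivation of `E`
(extended complex linearly) induced by the lift `z` of the vector field `Z`; in particular this
form is closed. -/
def IsKodairaSpencerClass {z : Sections EM FF V} {Z : VectorFields EB B} (hz : H.IsLift z Z)
    (κ : H.H2) : Prop :=
  ∃ ε : H.lieL.Z2,
    (∀ a b : H.secL, ε.1 ![a, b] = H.pairC ((H.derivE hz).baseChange ℂ a) b) ∧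
    κ = H.lieL.toH2 ε

end Reduction

end HolomorphicFamily

end GenCx

end

set_option linter.unusedSectionVars false

/-! ### Isotropy of eigenspaces -/

namespace GenCx

/-! Lifts exist locally because `p_* ∘ ρ` is surjective, and globally because the lifts form an
affine space in each fibre, so that a partition of unity glues them (`exists_isLift`).

Fix a lift `z` with induced derivation `D`. Orthogonality of `J` gives `⟨a,b⟩ = ⟨Ja,Jb⟩ = i²⟨a,b⟩`
on the `+i`-eigenbundle, so `L` is isotropic. Differentiating `⟨a,b⟩ = 0` along `z` shows that
`⟨Da,b⟩` is skew; the term `ρ(z)(f)⟨a,b⟩` in the Leibniz rule drops out for the same reason, so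
`⟨Da,b⟩` is tensorial. It is closed because `D` is a derivation of the bracket, the pairing is
invariant under the bracket and `L` is involutive (`kodairaSpencerAlt_closed`).

Two lifts of one field differ by a section `v` of `A`, and their derivations by `[v,·]`. The Courant
axioms turn `⟨[v,a],b⟩` into the differential of the one-form `-⟨v,·⟩` on `L`, so the class is
independent of the lift (`toH2_kodairaSpencerForm_eq`). Real linearity follows, since sums and real
multiples of lifts are lifts.

For complex linearity the lift of `IX` is chosen well. As `J` induces `-I` on the quotient by `A`,
`-Jz` lifts `IX`. The section `ℓ = -Jz - iz` lies in the `+i`-eigenbundle of the whole Courant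
algebroid. By integrability `[ℓ,a]` stays there when `a` does, and by isotropy `⟨[ℓ,a],b⟩ = 0`. So
the form of `-Jz` equals `i` times the form of `z`, even before passing to cohomology
(`kodairaSpencerForm_neg_J`). -/

lemma eq_zero_of_eq_neg (K : Type*) {N : Type*} [Field K] [CharZero K] [AddCommGroup N]
    [Module K N] {x : N} (h : x = -x) : x = 0 := by
  have h2 : (2 : K) • x = 0 := by
    rw [two_smul]
    exact add_eq_zero_iff_eq_neg.mpr h
  exact (smul_eq_zero.mp h2).resolve_left two_ne_zero

/-- The `+i`-eigenspace of an orthogonal endomorphism is isotropic. -/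
lemma complexify₂_eq_zero_of_mem_eigenspace {N Q : Type*} [AddCommGroup N] [Module ℝ N]
    [AddCommGroup Q] [Module ℝ Q] {f : N →ₗ[ℝ] N →ₗ[ℝ] Q} {J : N →ₗ[ℝ] N}
    (hJ : ∀ a b, f (J a) (J b) = f a b) {a b : ℂ ⊗[ℝ] N}
    (ha : a ∈ Module.End.eigenspace (J.baseChange ℂ) Complex.I)
    (hb : b ∈ Module.End.eigenspace (J.baseChange ℂ) Complex.I) : complexify₂ f a b = 0 := by
  have h : ∀ a b : ℂ ⊗[ℝ] N,
      complexify₂ f (J.baseChange ℂ a) (J.baseChange ℂ b) = complexify₂ f a b := by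
    intro a b
    induction a with
    | zero => simp
    | add a a' ha hb => simp only [map_add, LinearMap.add_apply, ha, hb]
    | tmul w a =>
      induction b with
      | zero => simp
      | add b b' ha hb => simp only [map_add, ha, hb]
      | tmul w' b => simp only [LinearMap.baseChange_tmul, complexify₂_tmul, hJ]
  -- On the eigenspace both arguments produce a factor `i`, so invariance reads `-f(a,b) = f(a,b)`.
  have h' := h a b
  rw [Module.End.mem_eigenspace_iff.mp ha, Module.End.mem_eigenspace_iff.mp hb] at h'
  simp only [map_smul, LinearMap.smul_apply, smul_smul, Complex.I_mul_I, neg_smul, one_smul] at h'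
  exact eq_zero_of_eq_neg ℂ h'.symm

/-! ### Classes in degree two -/

namespace LieAlgebroidOps

variable {F L : Type*} [CommRing F] [Algebra ℂ F] [AddCommGroup L] [Module ℂ L]
  (O : LieAlgebroidOps F L)

lemma toH2_add (θ η : O.Z2) : O.toH2 (θ + η) = O.toH2 θ + O.toH2 η := map_add O.toH2 θ η

lemma toH2_smul (c : ℂ) (θ : O.Z2) : O.toH2 (c • θ) = c • O.toH2 θ := map_smul O.toH2 c θ

lemma toH2_eq_iff (θ η : O.Z2) : O.toH2 θ = O.toH2 η ↔ (θ - η).1 ∈ O.B2 := by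
  rw [← sub_eq_zero, ← map_sub, toH2_eq_zero_iff]

end LieAlgebroidOps

namespace HolomorphicFamily

variable {EM EB E₀ : Type*}
    [NormedAddCommGroup EM] [NormedSpace ℝ EM] [FiniteDimensional ℝ EM]
    [NormedAddCommGroup EB] [NormedSpace ℝ EB] [FiniteDimensional ℝ EB]
    [NormedAddCommGroup E₀] [NormedSpace ℝ E₀]
    {M B M₀ : Type*} [TopologicalSpace M] [ChartedSpace EM M] [IsManifold 𝓘(ℝ, EM) ∞ M]
    [T2Space M] [SigmaCompactSpace M]
    [TopologicalSpace B] [ChartedSpace EB B] [IsManifold 𝓘(ℝ, EB) ∞ B]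
    [T2Space B] [SigmaCompactSpace B]
    [TopologicalSpace M₀] [ChartedSpace E₀ M₀]
    {FF : Type*} [NormedAddCommGroup FF] [NormedSpace ℝ FF]
    {V : M → Type*} [TopologicalSpace (Bundle.TotalSpace FF V)]
    [∀ x, AddCommGroup (V x)] [∀ x, Module ℝ (V x)] [∀ x, TopologicalSpace (V x)]
    [FiberBundle FF V] [VectorBundle ℝ FF V] [ContMDiffVectorBundle ∞ FF V 𝓘(ℝ, EM)]
    (H : HolomorphicFamily EM EB E₀ M B M₀ FF V)

/-! ### Lifts of vector fields -/

/-- A vector field on the base lifts near every point, by Cramer's rule. -/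
lemma exists_local_lift (X : VectorFields EB B) (x : M) :
    ∃ U ∈ nhds x, ∃ s : ∀ y, V y,
      ContMDiffOn 𝓘(ℝ, EM) (𝓘(ℝ, EM).prod 𝓘(ℝ, FF)) ∞
        (fun y => (⟨y, s y⟩ : Bundle.TotalSpace FF V)) U ∧
      ∀ y ∈ U, H.projAnchor y (s y) = X (H.proj y) := by
  obtain ⟨g, hg, e, he⟩ := exists_coordinate_functions (EB := EB) (H.proj x)
  choose v hv using fun j => H.projAnchor_surjective x (e j)
  choose z hz using fun j => exists_section_through (EM := EM) (FF := FF) x (v j)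
  let m : Matrix (Fin (Module.finrank ℝ EB)) (Fin (Module.finrank ℝ EB)) (SmoothFun EM M) :=
    fun i j => H.courant.act (z j) (H.pullback (g i))
  let u : Fin (Module.finrank ℝ EB) → SmoothFun EM M :=
    fun i => H.pullback (fieldDeriv X (g i))
  -- A lift has coefficients solving `m t = u`. The adjugate replaces the inverse so that `c` is a
  -- global smooth section; it solves the system up to the factor `det m`.
  let c : Sections EM FF V := ∑ j, funSmul EM FF V ((m.adjugate.mulVec u) j) (z j)
  have h1 : ∀ i, H.courant.act c (H.pullback (g i)) = m.det * u i := by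
    intro i
    have h2 : m.mulVec (m.adjugate.mulVec u) i = m.det * u i := by
      rw [Matrix.mulVec_mulVec, Matrix.mul_adjugate, Matrix.smul_mulVec, Matrix.one_mulVec]
      rfl
    simp only [c, map_sum, LinearMap.sum_apply, act_funSmul]
    refine Eq.trans ?_ h2
    exact Finset.sum_congr rfl fun j _ => mul_comm _ _
  -- At `x` the sections `z j` project to the vectors `e j`, which are dual to the differentials of
  -- the `g i`; hence `det m` is nonzero near `x`.
  have h3 : (ContMDiffMap.evalRingHom x : SmoothFun EM M →+* ℝ).mapMatrix m = 1 := by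
    ext i j
    change H.courant.act (z j) (H.pullback (g i)) x = _
    rw [act_pullback_apply, hz, hv, he, Matrix.one_apply]
  have h4 : m.det x ≠ 0 := by
    have : m.det x = 1 := by
      change (ContMDiffMap.evalRingHom x : SmoothFun EM M →+* ℝ) m.det = 1
      rw [RingHom.map_det, h3, Matrix.det_one]
    rw [this]
    exact one_ne_zero
  refine ⟨_, Filter.inter_mem (m.det.contMDiff.continuous.continuousAt.eventually_ne h4)
    (H.isFiberBundle.smooth.continuous.continuousAt.eventually hg),
    fun y => (m.det y)⁻¹ • c y, ?_, ?_⟩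
  · refine ContMDiffOn.smul_section (fun y hy => ?_) c.contMDiff.contMDiffOn
    exact ((m.det.contMDiff y).inv₀ hy.1).contMDiffWithinAt
  · rintro y ⟨hy, hy'⟩
    rw [← sub_eq_zero]
    -- The differentials of the `g i` separate tangent vectors near `H.proj x`, so it suffices to
    -- compare derivatives of the `g i`.
    refine hy' _ fun i => ?_
    let T : EB →L[ℝ] ℝ := mfderiv 𝓘(ℝ, EB) 𝓘(ℝ, ℝ) (g i) (H.proj y)
    have h5 : dirDeriv (g i) (H.proj y) (H.projAnchor y (c y)) =
        m.det y * dirDeriv (g i) (H.proj y) (X (H.proj y)) := by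
      rw [← act_pullback_apply, h1]
      rfl
    change T (H.projAnchor y ((m.det y)⁻¹ • c y) - X (H.proj y)) = 0
    have h6 : T (H.projAnchor y ((m.det y)⁻¹ • c y)) = T (X (H.proj y)) := by
      rw [map_smul]
      refine (map_smul T _ _).trans ?_
      change (m.det y)⁻¹ * dirDeriv (g i) (H.proj y) (H.projAnchor y (c y)) = _
      rw [h5]
      exact inv_mul_cancel_left₀ hy _
    exact (map_sub T _ _).trans (sub_eq_zero.mpr h6)

/-- The condition on the value at each point is affine, hence convex, so local lifts are patched by
a smooth partition of unity. -/
lemma exists_isLift (X : VectorFields EB B) : ∃ z : Sections EM FF V, H.IsLift z X := by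
  refine exists_contMDiffSection_forall_mem_convex_of_local (n := (⊤ : ℕ∞))
    𝓘(ℝ, EM) V (fun y => {v | H.projAnchor y v = X (H.proj y)}) (fun y => ?_) (fun x => ?_)
  · intro v hv w hw a b _ _ hab
    change H.projAnchor y (a • v + b • w) = _
    rw [map_add, map_smul, map_smul, hv, hw, ← add_smul, hab, one_smul]
  · obtain ⟨U, hU, s, hs, h⟩ := H.exists_local_lift X x
    exact ⟨U, hU, s, hs, h⟩

variable {H}

lemma IsLift.add {z w : Sections EM FF V} {Z W : VectorFields EB B} (hz : H.IsLift z Z)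
    (hw : H.IsLift w W) : H.IsLift (z + w) (Z + W) := fun x =>
  (map_add (H.projAnchor x) (z x) (w x)).trans (congrArg₂ (· + ·) (hz x) (hw x))

lemma IsLift.smul (r : ℝ) {z : Sections EM FF V} {Z : VectorFields EB B} (hz : H.IsLift z Z) :
    H.IsLift (r • z) (r • Z) := fun x =>
  (map_smul (H.projAnchor x) r (z x)).trans (congrArg (r • ·) (hz x))

lemma IsLift.sub_mem_secA {z w : Sections EM FF V} {Z : VectorFields EB B} (hz : H.IsLift z Z)
    (hw : H.IsLift w Z) : z - w ∈ H.secA := fun x =>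
  (map_sub (H.projAnchor x) (z x) (w x)).trans (sub_eq_zero.mpr ((hz x).trans (hw x).symm))

/-- If `z` lifts `Z` then `-Jz` lifts `IZ`. -/
lemma IsLift.neg_J {z : Sections EM FF V} {Z : VectorFields EB B} (hz : H.IsLift z Z) :
    H.IsLift (-H.Jsec z) (H.baseStructure.onFields Z) := by
  intro x
  refine (map_neg (H.projAnchor x) (H.gcs.J x (z x))).trans ?_
  -- The sign in `-Jz` cancels the sign of the structure `-p^*I` induced on the quotient by `A`.
  refine (congrArg Neg.neg (H.induced x (z x))).trans ?_
  rw [neg_neg]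
  exact congrArg (H.baseStructure.J (H.proj x)) (hz x)

/-! ### Identities on `Γ(E)` and their complexifications -/

section Identities

variable {z : Sections EM FF V} {Z : VectorFields EB B} (hz : H.IsLift z Z)

/-- This and the next identities are Courant algebroid identities on representatives in `Γ(A)`; the
operations on the quotient compute definitionally there. -/
lemma act_pairE_of_isLift (a b : H.SecE) : H.courant.act z (H.pairE a b) =
    H.pairE (H.derivE hz a) b + H.pairE a (H.derivE hz b) := by
  obtain ⟨a, rfl⟩ := Submodule.mkQ_surjective _ a
  obtain ⟨b, rfl⟩ := Submodule.mkQ_surjective _ b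
  exact H.courant.act_pairSec z a b

lemma derivE_bracketE (a b : H.SecE) : H.derivE hz (H.bracketE a b) =
    H.bracketE (H.derivE hz a) b + H.bracketE a (H.derivE hz b) := by
  obtain ⟨a, rfl⟩ := Submodule.mkQ_surjective _ a
  obtain ⟨b, rfl⟩ := Submodule.mkQ_surjective _ b
  exact congrArg H.toE (Subtype.ext (H.courant.bracket_jacobi z a b))

lemma derivE_smulE (f : SmoothFun EM M) (a : H.SecE) : H.derivE hz (H.smulE f a) =
    H.smulE (H.courant.act z f) a + H.smulE f (H.derivE hz a) := by
  obtain ⟨a, rfl⟩ := Submodule.mkQ_surjective _ a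
  exact congrArg H.toE (Subtype.ext (H.courant.bracket_funSmul z a f))

variable (H)

lemma pairE_symm (a b : H.SecE) : H.pairE a b = H.pairE b a := by
  obtain ⟨a, rfl⟩ := Submodule.mkQ_surjective _ a
  obtain ⟨b, rfl⟩ := Submodule.mkQ_surjective _ b
  exact H.pairSec_symm a b

lemma pairE_smulE (f : SmoothFun EM M) (a b : H.SecE) :
    H.pairE (H.smulE f a) b = f * H.pairE a b := by
  obtain ⟨a, rfl⟩ := Submodule.mkQ_surjective _ a
  obtain ⟨b, rfl⟩ := Submodule.mkQ_surjective _ b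
  ext x
  exact LinearMap.map_smul₂ (H.courant.pairing x) _ _ _

lemma pairE_JE (a b : H.SecE) : H.pairE (H.JE a) (H.JE b) = H.pairE a b := by
  obtain ⟨a, rfl⟩ := Submodule.mkQ_surjective _ a
  obtain ⟨b, rfl⟩ := Submodule.mkQ_surjective _ b
  ext x
  exact H.gcs.orthogonal x _ _

lemma actE_pairE (a b c : H.SecE) : H.actE a (H.pairE b c) =
    H.pairE (H.bracketE a b) c + H.pairE b (H.bracketE a c) := by
  obtain ⟨a, rfl⟩ := Submodule.mkQ_surjective _ a
  obtain ⟨b, rfl⟩ := Submodule.mkQ_surjective _ b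
  obtain ⟨c, rfl⟩ := Submodule.mkQ_surjective _ c
  exact H.courant.act_pairSec a b c

/-- The symmetric part of the Dorfman bracket is a differential. After pairing with `c`, the factors
2 and 1/2 of the axiom cancel. -/
lemma pairE_bracketE_add_swap (a b c : H.SecE) :
    H.pairE (H.bracketE a b) c + H.pairE (H.bracketE b a) c = H.actE c (H.pairE a b) := by
  obtain ⟨a, rfl⟩ := Submodule.mkQ_surjective _ a
  obtain ⟨b, rfl⟩ := Submodule.mkQ_surjective _ b
  obtain ⟨c, rfl⟩ := Submodule.mkQ_surjective _ c
  ext x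
  have h := H.courant.bracket_add_swap a b x ((c : Sections EM FF V) x)
  rw [LinearMap.map_add₂, ← mul_assoc, mul_one_div_cancel two_ne_zero, one_mul] at h
  exact h

/-- The bracket with `v` in terms of the Lie algebroid differential of `⟨v, ·⟩`. -/
lemma pairE_bracketE (v a b : H.SecE) : H.pairE (H.bracketE v a) b =
    H.actE b (H.pairE v a) - H.actE a (H.pairE v b) + H.pairE v (H.bracketE a b) := by
  rw [← H.pairE_bracketE_add_swap, H.actE_pairE a v b]
  abel

/-! The complexified identities. -/

variable {H}

/-- Both sides are complex multilinear, so pure tensors suffice, and there the real identity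
applies. The other complexifications follow the same pattern. -/
lemma actC_pairC_of_isLift (a b : ℂ ⊗[ℝ] H.SecE) :
    (H.courant.act z).baseChange ℂ (H.pairC a b) =
      H.pairC ((H.derivE hz).baseChange ℂ a) b + H.pairC a ((H.derivE hz).baseChange ℂ b) := by
  simp only [pairC]
  induction a with
  | zero => simp
  | add a a' ha hb => simp only [map_add, LinearMap.add_apply, ha, hb]; abel
  | tmul w a =>
    induction b with
    | zero => simp
    | add b b' ha hb => simp only [map_add, ha, hb]; abel
    | tmul w' b =>
      simp only [LinearMap.baseChange_tmul, complexify₂_tmul, act_pairE_of_isLift hz,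
        TensorProduct.tmul_add]

lemma derivC_bracketC (a b : ℂ ⊗[ℝ] H.SecE) :
    (H.derivE hz).baseChange ℂ (complexify₂ H.bracketE a b) =
      complexify₂ H.bracketE ((H.derivE hz).baseChange ℂ a) b +
        complexify₂ H.bracketE a ((H.derivE hz).baseChange ℂ b) := by
  induction a with
  | zero => simp
  | add a a' ha hb => simp only [map_add, LinearMap.add_apply, ha, hb]; abel
  | tmul w a =>
    induction b with
    | zero => simp
    | add b b' ha hb => simp only [map_add, ha, hb]; abel
    | tmul w' b =>
      simp only [LinearMap.baseChange_tmul, complexify₂_tmul, derivE_bracketE hz,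
        TensorProduct.tmul_add]

lemma derivC_smulC (f : ℂ ⊗[ℝ] SmoothFun EM M) (a : ℂ ⊗[ℝ] H.SecE) :
    (H.derivE hz).baseChange ℂ (complexify₂ H.smulE f a) =
      complexify₂ H.smulE ((H.courant.act z).baseChange ℂ f) a +
        complexify₂ H.smulE f ((H.derivE hz).baseChange ℂ a) := by
  induction f with
  | zero => simp
  | add f f' ha hb => simp only [map_add, LinearMap.add_apply, ha, hb]; abel
  | tmul w f =>
    induction a with
    | zero => simp
    | add a a' ha hb => simp only [map_add, ha, hb]; abel
    | tmul w' a =>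
      simp only [LinearMap.baseChange_tmul, complexify₂_tmul, derivE_smulE hz,
        TensorProduct.tmul_add]

variable (H)

lemma pairC_symm (a b : ℂ ⊗[ℝ] H.SecE) : H.pairC a b = H.pairC b a := by
  simp only [pairC]
  induction a with
  | zero => simp
  | add a a' ha hb => simp only [map_add, LinearMap.add_apply, ha, hb]
  | tmul w a =>
    induction b with
    | zero => simp
    | add b b' ha hb => simp only [map_add, LinearMap.add_apply, ha, hb]
    | tmul w' b => rw [complexify₂_tmul, complexify₂_tmul, mul_comm, pairE_symm]

lemma pairC_smulC (f : ℂ ⊗[ℝ] SmoothFun EM M) (a b : ℂ ⊗[ℝ] H.SecE) :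
    H.pairC (complexify₂ H.smulE f a) b = f * H.pairC a b := by
  simp only [pairC]
  induction f with
  | zero => simp
  | add f f' ha hb => simp only [map_add, LinearMap.add_apply, ha, hb, add_mul]
  | tmul w f =>
    induction a with
    | zero => simp
    | add a a' ha hb => simp only [map_add, LinearMap.add_apply, ha, hb, mul_add]
    | tmul w' a =>
      induction b with
      | zero => simp
      | add b b' ha hb => simp only [map_add, ha, hb, mul_add]
      | tmul w'' b =>
        simp only [complexify₂_tmul, pairE_smulE, Algebra.TensorProduct.tmul_mul_tmul, mul_assoc]

lemma actC_pairC (a b c : ℂ ⊗[ℝ] H.SecE) : complexify₂ H.actE a (H.pairC b c) =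
    H.pairC (complexify₂ H.bracketE a b) c + H.pairC b (complexify₂ H.bracketE a c) := by
  simp only [pairC]
  induction a with
  | zero => simp
  | add a a' ha hb => simp only [map_add, LinearMap.add_apply, ha, hb]; abel
  | tmul w a =>
    induction b with
    | zero => simp
    | add b b' ha hb => simp only [map_add, LinearMap.add_apply, ha, hb]; abel
    | tmul w' b =>
      induction c with
      | zero => simp
      | add c c' ha hb => simp only [map_add, ha, hb]; abel
      | tmul w'' c =>
        simp only [complexify₂_tmul, actE_pairE, TensorProduct.tmul_add, mul_assoc,
          mul_left_comm w w']

lemma pairC_bracketC (v a b : ℂ ⊗[ℝ] H.SecE) : H.pairC (complexify₂ H.bracketE v a) b =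
    complexify₂ H.actE b (H.pairC v a) - complexify₂ H.actE a (H.pairC v b) +
      H.pairC v (complexify₂ H.bracketE a b) := by
  simp only [pairC]
  induction v with
  | zero => simp
  | add a a' ha hb => simp only [map_add, LinearMap.add_apply, ha, hb]; abel
  | tmul w v =>
    induction a with
    | zero => simp
    | add b b' ha hb => simp only [map_add, LinearMap.add_apply, ha, hb]; abel
    | tmul w' a =>
      induction b with
      | zero => simp
      | add c c' ha hb => simp only [map_add, LinearMap.add_apply, ha, hb]; abel
      | tmul w'' b =>
        simp only [complexify₂_tmul, pairE_bracketE, TensorProduct.tmul_add,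
          TensorProduct.tmul_sub]
        -- The arguments occur in a different order in each term, so the scalar factors have to be
        -- brought to one common form.
        rw [show w'' * (w * w') = w * w' * w'' by ring, show w' * (w * w'') = w * w' * w'' by ring,
          show w * (w' * w'') = w * w' * w'' by ring]

/-- `L` is isotropic. -/
lemma pairC_eq_zero {a b : ℂ ⊗[ℝ] H.SecE} (ha : a ∈ H.secL) (hb : b ∈ H.secL) :
    H.pairC a b = 0 :=
  complexify₂_eq_zero_of_mem_eigenspace H.pairE_JE ha hb

end Identities

/-! ### The Kodaira–Spencer form of a lift -/

section Form

variable {z : Sections EM FF V} {Z : VectorFields EB B} (hz : H.IsLift z Z)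

/-- `L` is isotropic, so the Leibniz rule for `D` is applied to the zero function `⟨a,b⟩`. Neither
`Da` nor `Db` needs to lie in `L`. -/
lemma pairC_derivC_swap {a b : ℂ ⊗[ℝ] H.SecE} (ha : a ∈ H.secL) (hb : b ∈ H.secL) :
    H.pairC ((H.derivE hz).baseChange ℂ a) b = -H.pairC ((H.derivE hz).baseChange ℂ b) a := by
  have h := actC_pairC_of_isLift hz a b
  rw [H.pairC_eq_zero ha hb, map_zero, H.pairC_symm a] at h
  exact eq_neg_of_add_eq_zero_left h.symm

lemma pairC_derivC_self {a : ℂ ⊗[ℝ] H.SecE} (ha : a ∈ H.secL) :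
    H.pairC ((H.derivE hz).baseChange ℂ a) a = 0 :=
  eq_zero_of_eq_neg ℂ (pairC_derivC_swap hz ha ha)

/-- The form `a, b ↦ ⟨Da, b⟩` on `L`, where `D` is induced by the lift `z`. -/
noncomputable def kodairaSpencerAlt : H.secL [⋀^Fin 2]→ₗ[ℂ] H.CFun where
  toFun v := H.pairC ((H.derivE hz).baseChange ℂ (v 0)) (v 1)
  map_update_add' {i₀} v i x y := by
    -- The field quantifies over an arbitrary decidability instance; it is replaced by the standard
    -- one so that the updates can be evaluated.
    rw [Subsingleton.elim i₀ (instDecidableEqFin 2)]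
    fin_cases i <;> simp [pairC]
  map_update_smul' {i₀} v i c x := by
    rw [Subsingleton.elim i₀ (instDecidableEqFin 2)]
    fin_cases i <;> simp [pairC]
  map_eq_zero_of_eq' v i j h hij := by
    have h' : v 1 = v 0 := by
      fin_cases i <;> fin_cases j <;> simp_all
    rw [h']
    exact pairC_derivC_self hz (v 0).2

lemma kodairaSpencerAlt_apply (a b : H.secL) :
    kodairaSpencerAlt hz ![a, b] = H.pairC ((H.derivE hz).baseChange ℂ a) b := rfl

/-- Linearity over functions in the first argument holds because the Leibniz term pairs two sections
of `L`; skew-symmetry carries it to the second argument. -/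
lemma kodairaSpencerAlt_mem_cochain : kodairaSpencerAlt hz ∈ H.lieL.Cochain 2 := by
  have h : ∀ (f : H.CFun) (a b : H.secL), kodairaSpencerAlt hz ![H.smulL f a, b] =
      f * kodairaSpencerAlt hz ![a, b] := by
    intro f a b
    simp only [kodairaSpencerAlt_apply, smulL, derivC_smulC]
    have h0 : H.pairC (complexify₂ H.smulE ((H.courant.act z).baseChange ℂ f) a) b = 0 := by
      rw [pairC_smulC, H.pairC_eq_zero a.2 b.2, mul_zero]
    refine Eq.trans ?_ (congrArg₂ (· + ·) h0 (H.pairC_smulC f _ b.1)) |>.trans (zero_add _)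
    simp only [pairC, map_add, LinearMap.add_apply]
  have hs : ∀ a b : H.secL, kodairaSpencerAlt hz ![a, b] = -kodairaSpencerAlt hz ![b, a] :=
    fun a b => pairC_derivC_swap hz a.2 b.2
  have hv : ∀ v : Fin 2 → H.secL, v = ![v 0, v 1] := fun v => List.ofFn_inj.mp rfl
  intro f v i
  rw [hv (Function.update _ _ _), hv v]
  fin_cases i
  · exact h f (v 0) (v 1)
  · refine (hs _ _).trans ?_
    rw [hs (v 0)]
    refine (congrArg Neg.neg (h f (v 1) (v 0))).trans ?_
    exact (mul_neg (α := H.CFun) f _).symm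

/-- The derivation property splits `⟨D[a,b],c⟩` into `⟨[Da,b],c⟩ + ⟨[a,Db],c⟩`. Invariance of the
pairing rewrites the second summand, and the formula for `⟨[v,b],c⟩` with `v = Da` rewrites the
first; together they produce the three anchor terms of the differential. -/
lemma kodairaSpencerAlt_closed (a b c : H.secL) : H.lieL.d₂ (kodairaSpencerAlt hz) a b c = 0 := by
  have h1 := H.actC_pairC a ((H.derivE hz).baseChange ℂ b) c
  have h2 := H.pairC_bracketC ((H.derivE hz).baseChange ℂ a) b c
  have h3 := congrArg (fun e => H.pairC e c) (derivC_bracketC hz a.1 b.1)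
  -- The remaining terms match after moving `D` off the bracket, which is allowed because `L` is
  -- involutive.
  have h4 := pairC_derivC_swap hz (H.bracket_mem_secL a.2 c.2) b.2
  have h5 := pairC_derivC_swap hz (H.bracket_mem_secL b.2 c.2) a.2
  simp only [LieAlgebroidOps.d₂, kodairaSpencerAlt_apply]
  simp only [lieL, actL, bracketL]
  simp only [pairC, map_add, LinearMap.add_apply] at *
  linear_combination h1 - h2 - h3 + h4 - h5

/-- The closed element `a, b ↦ ⟨Da, b⟩` of `Γ(∧² L^*)`. -/
noncomputable def kodairaSpencerForm : H.lieL.Z2 :=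
  ⟨kodairaSpencerAlt hz, kodairaSpencerAlt_mem_cochain hz, kodairaSpencerAlt_closed hz⟩

lemma Z2_ext {θ θ' : H.lieL.Z2} (h : ∀ a b, θ.1 ![a, b] = θ'.1 ![a, b]) : θ = θ' := by
  refine Subtype.ext (AlternatingMap.ext fun v => ?_)
  have hv : v = ![v 0, v 1] := List.ofFn_inj.mp rfl
  rw [hv]
  exact h _ _

lemma kodairaSpencerForm_add {w : Sections EM FF V} {W : VectorFields EB B} (hw : H.IsLift w W) :
    kodairaSpencerForm (hz.add hw) = kodairaSpencerForm hz + kodairaSpencerForm hw := by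
  have h : H.derivE (hz.add hw) = H.derivE hz + H.derivE hw := by
    refine Submodule.linearMap_qext _ (LinearMap.ext fun a => congrArg H.toE (Subtype.ext ?_))
    exact LinearMap.map_add₂ H.courant.bracket z w a
  refine Z2_ext fun a b => ?_
  change H.pairC _ _ = H.pairC _ _ + H.pairC _ _
  simp only [h, pairC, LinearMap.baseChange_add, LinearMap.add_apply, map_add]

lemma kodairaSpencerForm_smul (r : ℝ) :
    kodairaSpencerForm (hz.smul r) = (r : ℂ) • kodairaSpencerForm hz := by
  have h : H.derivE (hz.smul r) = r • H.derivE hz := by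
    refine Submodule.linearMap_qext _ (LinearMap.ext fun a => congrArg H.toE (Subtype.ext ?_))
    exact LinearMap.map_smul₂ H.courant.bracket r z a
  have h' : ∀ a : ℂ ⊗[ℝ] H.SecE, (r • H.derivE hz).baseChange ℂ a =
      (r : ℂ) • (H.derivE hz).baseChange ℂ a := by
    intro a
    rw [LinearMap.baseChange_smul, LinearMap.smul_apply, ← algebraMap_smul ℂ]
    rfl
  refine Z2_ext fun a b => ?_
  change H.pairC _ _ = (r : ℂ) • H.pairC _ _
  simp only [h, h', pairC, LinearMap.smul_apply, map_smul]

/-- A single lift need not lie in `A`, so its derivation need not be a bracket in `E`; the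
difference of two lifts of the same field does lie in `A`, which makes the difference of the
derivations inner. -/
lemma derivC_sub_derivC {w : Sections EM FF V} (hw : H.IsLift w Z) (a : ℂ ⊗[ℝ] H.SecE) :
    (H.derivE hz).baseChange ℂ a - (H.derivE hw).baseChange ℂ a =
      complexify₂ H.bracketE (1 ⊗ₜ H.toE ⟨z - w, hz.sub_mem_secA hw⟩) a := by
  have h : ∀ a, H.derivE hz a - H.derivE hw a =
      H.bracketE (H.toE ⟨z - w, hz.sub_mem_secA hw⟩) a := by
    intro a
    obtain ⟨a, rfl⟩ := Submodule.mkQ_surjective _ a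
    exact congrArg H.toE (Subtype.ext (LinearMap.map_sub₂ H.courant.bracket z w a).symm)
  induction a with
  | zero => simp
  | add a a' ha hb => rw [map_add, map_add, map_add, ← ha, ← hb]; abel
  | tmul c a =>
    simp only [LinearMap.baseChange_tmul, complexify₂_tmul, ← h, TensorProduct.tmul_sub, one_mul]

/-- The class does not depend on the lift: the forms of two lifts differ by the differential of
`-⟨v, ·⟩`, where `v ∈ Γ(E)` is the class of the difference of the lifts. -/
lemma toH2_kodairaSpencerForm_eq {w : Sections EM FF V} (hw : H.IsLift w Z) :
    H.lieL.toH2 (kodairaSpencerForm hz) = H.lieL.toH2 (kodairaSpencerForm hw) := by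
  rw [LieAlgebroidOps.toH2_eq_iff]
  let v : ℂ ⊗[ℝ] H.SecE := 1 ⊗ₜ H.toE ⟨z - w, hz.sub_mem_secA hw⟩
  -- The sign is forced by `pairC_bracketC`, which expresses `⟨[v,a],b⟩` as minus the differential
  -- of `⟨v,·⟩`.
  let η : H.secL [⋀^Fin 1]→ₗ[ℂ] H.CFun := AlternatingMap.ofSubsingleton ℂ H.secL H.CFun (0 : Fin 1)
    (-(complexify₂ H.pairE v ∘ₗ H.secL.subtype))
  have hη : ∀ a : Fin 1 → H.secL, η a = -H.pairC v (a 0) := fun a => rfl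
  refine ⟨(kodairaSpencerForm hz - kodairaSpencerForm hw).2.1, η, ?_, fun a b => ?_⟩
  · intro f a i
    rw [Subsingleton.elim i 0, hη, hη, Function.update_self, H.pairC_symm, H.pairC_symm v]
    refine (congrArg Neg.neg (H.pairC_smulC f (a 0) v)).trans ?_
    exact (mul_neg (α := H.CFun) f _).symm
  · have h1 := H.pairC_bracketC v a b
    rw [← derivC_sub_derivC hz hw] at h1
    change H.pairC ((H.derivE hz).baseChange ℂ a) b - H.pairC ((H.derivE hw).baseChange ℂ a) b =
      complexify₂ H.actE a (-H.pairC v b) - complexify₂ H.actE b (-H.pairC v a) -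
        -H.pairC v (complexify₂ H.bracketE a b)
    simp only [pairC, map_sub, LinearMap.sub_apply, map_neg] at h1 ⊢
    rw [h1]
    abel

/-! ### Complex linearity -/

/-- Sections of `L` lift to sections of the `+i`-eigenbundle of `A ⊗ ℂ`. -/
lemma exists_eigen_lift {a : ℂ ⊗[ℝ] H.SecE} (ha : a ∈ H.secL) : ∃ c : ℂ ⊗[ℝ] H.secA,
    H.secA.subtype.baseChange ℂ c ∈ Module.End.eigenspace (H.Jsec.baseChange ℂ) Complex.I ∧
      H.toE.baseChange ℂ c = a := by
  have hJ2 : ∀ a : ℂ ⊗[ℝ] H.secA, H.JA.baseChange ℂ (H.JA.baseChange ℂ a) = -a := by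
    intro a
    induction a with
    | zero => simp
    | add a b ha hb => simp only [map_add, ha, hb]; abel
    | tmul w a =>
      have : H.JA (H.JA a) = -a := by
        ext x
        exact H.gcs.sq x _
      simp [this, TensorProduct.tmul_neg]
  have hJq : ∀ a : ℂ ⊗[ℝ] H.secA, H.JE.baseChange ℂ (H.toE.baseChange ℂ a) =
      H.toE.baseChange ℂ (H.JA.baseChange ℂ a) := by
    intro a
    induction a with
    | zero => simp
    | add a b ha hb => simp only [map_add, ha, hb]
    | tmul w a => rfl
  have hJi : ∀ a : ℂ ⊗[ℝ] H.secA, H.Jsec.baseChange ℂ (H.secA.subtype.baseChange ℂ a) =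
      H.secA.subtype.baseChange ℂ (H.JA.baseChange ℂ a) := by
    intro a
    induction a with
    | zero => simp
    | add a b ha hb => simp only [map_add, ha, hb]
    | tmul w a => rfl
  obtain ⟨c, rfl⟩ : ∃ c, H.toE.baseChange ℂ c = a :=
    LinearMap.lTensor_surjective ℂ
      (Submodule.mkQ_surjective (H.secAperp.submoduleOf H.secA)) a
  rw [mem_secL, hJq] at ha
  -- The operator `(1 - iJ)/2` projects onto the `+i`-eigenspace. It is compatible with the quotient
  -- map and fixes `a`, so it turns any lift into an eigenvector with the same image.
  refine ⟨(1 / 2 : ℂ) • (c - Complex.I • H.JA.baseChange ℂ c), ?_, ?_⟩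
  · rw [Module.End.mem_eigenspace_iff, hJi]
    simp only [map_smul, map_sub, hJ2, smul_sub, smul_smul, smul_neg, map_neg]
    rw [mul_left_comm, Complex.I_mul_I]
    module
  · simp only [map_smul, map_sub, ha, smul_smul, Complex.I_mul_I]
    module

/-- Moves the form from `E` to the whole Courant algebroid, where `[z,·]` is a genuine bracket and
integrability of `J` applies although `z` need not lie in `A`. -/
lemma pairC_derivC_toE (c d : ℂ ⊗[ℝ] H.secA) :
    H.pairC ((H.derivE hz).baseChange ℂ (H.toE.baseChange ℂ c)) (H.toE.baseChange ℂ d) =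
      complexify₂ H.courant.pairSec
        (complexify₂ H.courant.bracket (1 ⊗ₜ z) (H.secA.subtype.baseChange ℂ c))
        (H.secA.subtype.baseChange ℂ d) := by
  simp only [pairC]
  induction c with
  | zero => simp
  | add a a' ha hb => simp only [map_add, LinearMap.add_apply, ha, hb]
  | tmul w c =>
    induction d with
    | zero => simp
    | add b b' ha hb => simp only [map_add, ha, hb]
    | tmul w' d =>
      simp only [LinearMap.baseChange_tmul, complexify₂_tmul, one_mul]
      rfl

/-- `-Jz - iz` lies in the `+i`-eigenbundle, so its bracket does not contribute on `L`. -/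
lemma kodairaSpencerForm_neg_J :
    kodairaSpencerForm hz.neg_J = Complex.I • kodairaSpencerForm hz := by
  refine Z2_ext fun a b => ?_
  obtain ⟨c, hc, hca⟩ := exists_eigen_lift a.2
  obtain ⟨d, hd, hdb⟩ := exists_eigen_lift b.2
  change H.pairC ((H.derivE hz.neg_J).baseChange ℂ a) b =
    Complex.I • H.pairC ((H.derivE hz).baseChange ℂ a) b
  rw [← hca, ← hdb, pairC_derivC_toE, pairC_derivC_toE, ← sub_eq_zero]
  have hJJ : H.Jsec (H.Jsec z) = -z := by
    ext x
    exact H.gcs.sq x _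
  -- Indeed `J(-Jz - iz) = z - iJz = i(-Jz - iz)`.
  have hℓ : (1 : ℂ) ⊗ₜ[ℝ] (-H.Jsec z) - Complex.I • (1 : ℂ) ⊗ₜ[ℝ] z ∈
      Module.End.eigenspace (H.Jsec.baseChange ℂ) Complex.I := by
    rw [Module.End.mem_eigenspace_iff]
    simp only [map_sub, map_smul, LinearMap.baseChange_tmul, map_neg, hJJ, neg_neg, smul_sub,
      smul_smul, Complex.I_mul_I, TensorProduct.tmul_neg]
    module
  -- Integrability puts the bracket of this section with the lift of `a` in the `+i`-eigenbundle,
  -- where its pairing with the lift of `b` vanishes.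
  have h := complexify₂_eq_zero_of_mem_eigenspace (f := H.courant.pairSec) (J := H.Jsec)
    (fun a b => by ext x; exact H.gcs.orthogonal x _ _) (H.gcs.integrable _ hℓ _ hc) hd
  simpa only [map_sub, map_smul, LinearMap.sub_apply, LinearMap.smul_apply] using h

end Form

/-! ### The Kodaira–Spencer map -/

variable (H)

/-- The Kodaira–Spencer class of a vector field on the base. -/
noncomputable def kodairaSpencerClass (X : VectorFields EB B) : H.H2 :=
  H.lieL.toH2 (kodairaSpencerForm (H.exists_isLift X).choose_spec)

variable {H}

/-- Frees the class from the chosen lift: below it is computed with the lifts `z + w`, `r • z` and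
`-Jz`. -/
lemma kodairaSpencerClass_eq {z : Sections EM FF V} {X : VectorFields EB B}
    (hz : H.IsLift z X) : H.kodairaSpencerClass X = H.lieL.toH2 (kodairaSpencerForm hz) :=
  toH2_kodairaSpencerForm_eq _ hz

lemma kodairaSpencerClass_add (X Y : VectorFields EB B) :
    H.kodairaSpencerClass (X + Y) = H.kodairaSpencerClass X + H.kodairaSpencerClass Y := by
  obtain ⟨z, hz⟩ := H.exists_isLift X
  obtain ⟨w, hw⟩ := H.exists_isLift Y
  refine (kodairaSpencerClass_eq (hz.add hw)).trans ?_
  refine (congrArg H.lieL.toH2 (kodairaSpencerForm_add hz hw)).trans ?_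
  refine (H.lieL.toH2_add _ _).trans ?_
  exact congrArg₂ (· + ·) (kodairaSpencerClass_eq hz).symm (kodairaSpencerClass_eq hw).symm

lemma kodairaSpencerClass_smul (r : ℝ) (X : VectorFields EB B) :
    H.kodairaSpencerClass (r • X) = (r : ℂ) • H.kodairaSpencerClass X := by
  obtain ⟨z, hz⟩ := H.exists_isLift X
  rw [kodairaSpencerClass_eq hz, kodairaSpencerClass_eq (hz.smul r), kodairaSpencerForm_smul]
  exact H.lieL.toH2_smul _ _

lemma kodairaSpencerClass_onFields (X : VectorFields EB B) :
    H.kodairaSpencerClass (H.baseStructure.onFields X) =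
      Complex.I • H.kodairaSpencerClass X := by
  obtain ⟨z, hz⟩ := H.exists_isLift X
  rw [kodairaSpencerClass_eq hz, kodairaSpencerClass_eq hz.neg_J, kodairaSpencerForm_neg_J]
  exact H.lieL.toH2_smul _ _

variable (H)

/-- The Kodaira–Spencer map. -/
noncomputable def kodairaSpencer : VectorFields EB B →ₗ[ℝ] H.H2 where
  toFun := H.kodairaSpencerClass
  map_add' := kodairaSpencerClass_add
  -- The real structure on `H²(L)` is the restriction of the complex one, so a real `r` acts as `(r
  -- : ℂ)`.
  map_smul' := kodairaSpencerClass_smul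

end HolomorphicFamily

end GenCx

/-! ### The proposition -/

theorem mainTheorem7
    {EM EB E₀ FF : Type*}
    [NormedAddCommGroup EM] [NormedSpace ℝ EM] [FiniteDimensional ℝ EM]
    [NormedAddCommGroup EB] [NormedSpace ℝ EB] [FiniteDimensional ℝ EB]
    [NormedAddCommGroup E₀] [NormedSpace ℝ E₀] [FiniteDimensional ℝ E₀]
    [NormedAddCommGroup FF] [NormedSpace ℝ FF] [FiniteDimensional ℝ FF]
    {M B M₀ : Type*}
    [TopologicalSpace M] [ChartedSpace EM M] [IsManifold 𝓘(ℝ, EM) ∞ M]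
    [T2Space M] [SigmaCompactSpace M]
    [TopologicalSpace B] [ChartedSpace EB B] [IsManifold 𝓘(ℝ, EB) ∞ B]
    [T2Space B] [SigmaCompactSpace B]
    [TopologicalSpace M₀] [ChartedSpace E₀ M₀] [IsManifold 𝓘(ℝ, E₀) ∞ M₀]
    [T2Space M₀] [SigmaCompactSpace M₀]
    {V : M → Type*} [TopologicalSpace (Bundle.TotalSpace FF V)]
    [∀ x, AddCommGroup (V x)] [∀ x, Module ℝ (V x)] [∀ x, TopologicalSpace (V x)]
    [FiberBundle FF V] [VectorBundle ℝ FF V] [ContMDiffVectorBundle ∞ FF V 𝓘(ℝ, EM)]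
    (H : GenCx.HolomorphicFamily EM EB E₀ M B M₀ FF V) :
    ∃ κ : GenCx.VectorFields EB B →ₗ[ℝ] H.H2,
      (∀ X : GenCx.VectorFields EB B,
        (∃ z : GenCx.Sections EM FF V, H.IsLift z X) ∧
        ∀ (z : GenCx.Sections EM FF V) (hz : H.IsLift z X),
          H.IsKodairaSpencerClass hz (κ X)) ∧
      ∀ X : GenCx.VectorFields EB B,
        κ (H.baseStructure.onFields X) = Complex.I • κ X := by
  refine ⟨H.kodairaSpencer, fun X => ⟨H.exists_isLift X, fun z hz => ?_⟩, fun X => ?_⟩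
  · exact ⟨GenCx.HolomorphicFamily.kodairaSpencerForm hz, fun _ _ => rfl,
      GenCx.HolomorphicFamily.kodairaSpencerClass_eq hz⟩
  · exact GenCx.HolomorphicFamily.kodairaSpencerClass_onFields X
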